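/- **Setting.** A system $A$ is a Hilbert space $\mathbb C^{d_A}$ with a fixed basis; it is non-trivial if $d_A\ge 2$. Elementary types are the finite-dimensional systems (including composites $AB$, with $\mathcal H_{AB}=\mathcal H_A\otimes\mathcal H_B$, and the trivial one-dimensional system $I$). Types are generated from elementary types by $(x,y)\mapsto (x\to y)$; no non-trivial system occurs twice in a type. $\mathsf{Ele}_x$ is the set of non-trivial elementary types occurring in $x$, and $\mathcal H_x=\bigotimes_{A\in \mathsf{Ele}_x}\mathcal H_A$ (tensor factors are identified by their labels, irrespective of order). The extension by a fresh elementary type $E$ is $A\|E=AE$, $(x\to y)\|E=x\to(y\|E)$. Admissible maps $T(x)$ and deterministic maps $T_1(x)$ are sets of operators on $\mathcal H_x$ defined recursively. For elementary $A$: $\rho\in T_1(A)$ iff $\rho\ge0$, $\operatorname{Tr}\rho=1$; $\rho\in T(A)$ iff $0\le\rho\le\sigma$ for some $\sigma\in T_1(A)$. For $x\to y$, an operator $M$, seen as the Choi operator of $\mathcal M:\mathcal L(\mathcal H_x)\to\mathcal L(\mathcal H_y)$, is in $T(x\to y)$ iff (i) $\mathcal M\otimes\mathcal I_E$ maps $T(x\|E)$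 into $T(y\|E)$ for all $E$, and (ii) there are finitely many (possibly zero) $N_i$ satisfying (i) such that $(\mathcal M+\sum_i\mathcal N_i)\otimes\mathcal I_E$ maps $T_1(x\|E)$ into $T_1(y\|E)$ for all $E$; $M\in T_1(x\to y)$ iff $M\in T(x\to y)$ and $\mathcal M\otimes \mathcal I_E$ maps $T_1(x\|E)$ into $T_1(y\|E)$ for all $E$. For $A\in\mathsf{Ele}_x$ let $K_x(A)\in\{0,1\}$ be the parity of the number of symbols "$\to$" and "$($" to the right of $A$ in the fully bracketed expression of $x$; $\mathsf{in}_x=\{A: K_x(A)=1\}$, $\mathsf{out}_x=\mathsf{Ele}_x\setminus\mathsf{in}_x$. For a finite label set $\mathsf A$ let $W_{\mathsf A}$ be the set of binary strings labelled by $\mathsf A$, $\mathbf e_{\mathsf A}=1\cdots1$, $T_{\mathsf A}=W_{\mathsf A}\setminus\{\mathbf e_{\mathsf A}\}$; juxtaposition denotes concatenation of labelled strings and of sets of them (the order of the labelled bits is irrelevant). Define $D_x\subseteq W_{\mathsf{Ele}_x}$ by $D_A=\{0\}$ for elementary $A\ne I$, $D_I=\emptyset$, and $D_{x\to y}=W_xD_y\cup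 (T_x\setminus D_x)(W_y\setminus D_y)$, where $W_x=W_{\mathsf{Ele}_x}$, $T_x=T_{\mathsf{Ele}_x}$. Let $A,A'\in\mathsf{Ele}_x$ be equivalent, i.e. of equal dimension, with bases identified by a bijection. For an operator $R$, $\mathcal C_{AA'}(R)=\operatorname{Tr}_{AA'}[R\,\Phi_{AA'}]$ with $\Phi_{AA'}=\sum_{i,j}|ii\rangle\langle jj|$ written in the identified bases. For $\mathsf H=\{(A_i,A_i')\}_{i=1}^n$, a set of mutually disjoint equivalent pairs, $\mathcal C_{\mathsf H}(R)=\mathcal C_{A_1A_1'}(\cdots\mathcal C_{A_nA_n'}(R)\cdots)$. The contraction $\mathcal C_{\mathsf H}(x)$ is *admissible* if for every $R\in T_1(x)$ there is a type $z$ with $\mathcal C_{\mathsf H}(R)\in T_1(z)$; similarly for $\mathcal C_{AA'}(x)$. **Statement.** Let $x$ be a type. 1. Let $\mathsf H=\{(A_i,A'_i)\}_{i=1}^n$ be a set of mutually disjoint pairs of equivalent non-trivial elementary types with $A_i\in\mathsf{in}_x$ and $A_i'\in\mathsf{out}_x$. Put $\mathsf{in}_{\mathsf H}=\{A_1,\dots,A_n\}$,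 $\mathsf{out}_{\mathsf H}=\{A'_1,\dots,A'_n\}$, $\widetilde{\mathsf{in}}=\mathsf{in}_x\setminus\mathsf{in}_{\mathsf H}$, $\widetilde{\mathsf{out}}=\mathsf{out}_x\setminus\mathsf{out}_{\mathsf H}$, and $$S^x_{\mathsf H}=\bigcup_{\mathbf b,\mathbf b'}W_{\widetilde{\mathsf{in}}}\,\mathbf b\,\mathbf e_{\widetilde{\mathsf{out}}}\,\mathbf b',$$ the union being over all $\mathbf b\in T_{\mathsf{in}_{\mathsf H}}$, $\mathbf b'\in T_{\mathsf{out}_{\mathsf H}}$ with $b_{A_i}=b'_{A'_i}$ for all $i$. Then $$\mathcal C_{\mathsf H}(x)\text{ is admissible}\iff D_x\cap S^x_{\mathsf H}=\emptyset .$$ 2. Let $A\in\mathsf{in}_x$ and $B\in\mathsf{out}_x$ be equivalent non-trivial elementary types and $S^x_{AB}=W_{\mathsf{in}_x\setminus\{A\}}\,0_A\,\mathbf e_{\mathsf{out}_x\setminus\{B\}}\,0_B$. Then $$\mathcal C_{AB}(x)\text{ is admissible}\iff D_x\cap S^x_{AB}=\emptyset .$$ -/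

import Mathlib

namespace HigherOrder

open scoped ComplexOrder

/-! ### Quantum systems and operators -/

/-- A non-trivial finite-dimensional quantum system: a Hilbert space `ℂ ^ dim` with its
computational basis, tagged by a label (infinitely many copies for every dimension `≥ 2`). -/
structure QSystem where
  dim : ℕ
  label : ℕ
  two_le : 2 ≤ dim
  deriving DecidableEq

/-- Labels of the computational basis of `⨂ i ∈ S, ℂ ^ (dim i)`. -/
abbrev Idx (S : Finset QSystem) : Type := ∀ i : S, Fin i.1.dim

/-- Operators on `⨂ i ∈ S, ℂ ^ (dim i)`; for `S = ∅` this is the space of operators on `ℂ`. -/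
abbrev Op (S : Finset QSystem) : Type := Matrix (Idx S) (Idx S) ℂ

/-- The basis label on `Q` that agrees with `a` on `X` and with `z` on `Z \ X`. It is only used
with `Q ⊆ X ∪ Z`, so that the last branch is never reached. -/
def glue {X Z : Finset QSystem} (Q : Finset QSystem) (a : Idx X) (z : Idx Z) : Idx Q :=
  fun i =>
    if h : i.1 ∈ X then a ⟨i.1, h⟩
    else if h : i.1 ∈ Z then z ⟨i.1, h⟩
    else ⟨0, Nat.lt_of_lt_of_le Nat.two_pos i.1.two_le⟩

/-! ### Types -/

/-- Types. `elem s` is the elementary type of the composite of the systems in `s`; in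
particular `elem {A}` is the system `A`, `elem {A, B}` is the bipartite system `AB`, and
`elem ∅` is the trivial (one-dimensional) system `I`. -/
inductive Ty where
  | elem (s : Finset QSystem) : Ty
  | arrow (x y : Ty) : Ty

namespace Ty

/-- The trivial type `I`. -/
def triv : Ty := elem ∅

/-- The systems on which a map of type `x` acts. -/
def systems : Ty → Finset QSystem
  | elem s => s
  | arrow x y => x.systems ∪ y.systems

/-- No system is used twice in the expression of the type. -/
def Linear : Ty → Prop
  | elem _ => True
  | arrow x y => x.Linear ∧ y.Linear ∧ Disjoint x.systems y.systems

/-- The extension `x ‖ E` of a type by an elementary type: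
`A ‖ E = AE`, `(x → y) ‖ E = x → (y ‖ E)`. -/
def ext : Ty → Finset QSystem → Ty
  | elem s, E => elem (s ∪ E)
  | arrow x y, E => arrow x (y.ext E)

/-- The number of elementary types in the expression of a type. -/
def size : Ty → ℕ
  | elem _ => 1
  | arrow x y => x.size + y.size

theorem size_pos (x : Ty) : 0 < x.size := by
  induction x with
  | elem s => simp [size]
  | arrow x y hx hy => simp only [size]; omega

theorem size_ext (x : Ty) (E : Finset QSystem) : (x.ext E).size = x.size := by
  induction x with
  | elem s => rfl
  | arrow x y _ hy => simp only [ext, size, hy]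

end Ty

/-! ### Admissible and deterministic maps -/

/-- Let `M` be the Choi operator of a linear map from operators on `X` to operators on `Y`
(acting on `P = X ∪ Y`), i.e. `M = ∑ a a', |a⟩⟨a'| ⊗ 𝓜(|a⟩⟨a'|)`. For an operator `R` on
`Q = X ∪ E`, this is the operator `(𝓜 ⊗ 𝓘_E)(R)` on `Z = Y ∪ E`, that is,
`∑ a a', ⟨a|R|a'⟩ ⊗ ⟨a|M|a'⟩` with `a, a'` running over the basis of `X`. -/
def choiApply (X : Finset QSystem) {P Q : Finset QSystem} (Z : Finset QSystem)
    (M : Op P) (R : Op Q) : Op Z :=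
  fun z w => ∑ a : Idx X, ∑ b : Idx X,
    R (glue Q a z) (glue Q b w) * M (glue P a z) (glue P b w)

namespace Ty

/-- The pair `(T(x), T₁(x))` of the set of admissible maps of type `x` and the set of
deterministic maps of type `x`, both given by Choi operators, by recursion on the type:

* `ρ` of elementary type is deterministic if `ρ ≥ 0` and `Tr ρ = 1`, and admissible if
  `0 ≤ ρ ≤ σ` for a deterministic `σ`;
* `M` of type `x → y` is admissible if (i) for every elementary type `E`, `𝓜 ⊗ 𝓘_E` sends
  admissible maps of type `x ‖ E` to admissible maps of type `y ‖ E`, and (ii) there are finitely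
  many `N₁, …, Nₙ` satisfying (i) such that, for every `E`, `(𝓜 + ∑ 𝓝ᵢ) ⊗ 𝓘_E` sends
  deterministic maps of type `x ‖ E` to deterministic maps of type `y ‖ E`;
* `D` of type `x → y` is deterministic if it is admissible and, for every `E`, `𝓓 ⊗ 𝓘_E` sends
  deterministic maps of type `x ‖ E` to deterministic maps of type `y ‖ E`.

The systems of `E` are always fresh. -/
noncomputable def maps : (x : Ty) → Set (Op x.systems) × Set (Op x.systems)
  | elem s =>
      ({M : Op s | M.PosSemidef ∧
          ∃ N : Op s, (N.PosSemidef ∧ N.trace = 1) ∧ (N - M).PosSemidef},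
       {M : Op s | M.PosSemidef ∧ M.trace = 1})
  | arrow x y =>
      let presAdm : Op (arrow x y).systems → Prop := fun M =>
        ∀ E : Finset QSystem, Disjoint E (arrow x y).systems →
          ∀ R ∈ (maps (x.ext E)).1,
            choiApply x.systems (y.ext E).systems M R ∈ (maps (y.ext E)).1
      let presDet : Op (arrow x y).systems → Prop := fun M =>
        ∀ E : Finset QSystem, Disjoint E (arrow x y).systems →
          ∀ R ∈ (maps (x.ext E)).2,
            choiApply x.systems (y.ext E).systems M R ∈ (maps (y.ext E)).2
      let adm : Op (arrow x y).systems → Prop := fun M =>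
        presAdm M ∧ ∃ (n : ℕ) (N : Fin n → Op (arrow x y).systems),
          (∀ i, presAdm (N i)) ∧ presDet (M + ∑ i, N i)
      ({M | adm M}, {M | adm M ∧ presDet M})
  termination_by x => x.size
  decreasing_by
    all_goals
      have h1 := size_pos x
      have h2 := size_pos y
      simp only [size_ext, size]
      omega

/-- `T(x)`: the admissible maps of type `x`. -/
noncomputable def admissibleMaps (x : Ty) : Set (Op x.systems) := x.maps.1

/-- `T₁(x)`: the deterministic maps of type `x`. -/
noncomputable def deterministicMaps (x : Ty) : Set (Op x.systems) := x.maps.2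

/-! ### Elementary types of a type, inputs and outputs -/

/-- `Ele_x`: the non-trivial elementary types occurring in the expression of `x`. -/
def ele : Ty → Finset (Finset QSystem)
  | elem s => if s = ∅ then ∅ else {s}
  | arrow x y => x.ele ∪ y.ele

/-- The number of arrows plus the number of open brackets in the expression of `x`, where
the expression of `arrow x y` is `(x → y)`. -/
def marks : Ty → ℕ
  | elem _ => 0
  | arrow x y => 1 + x.marks + 1 + y.marks

/-- The number of arrows plus the number of open brackets to the right of the elementary type
`A` in the expression of `x`. -/
def marksRight : Ty → Finset QSystem → ℕ
  | elem _, _ => 0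
  | arrow x y, A => if A ∈ x.ele then x.marksRight A + 1 + y.marks else y.marksRight A

/-- `in_x`: the elementary types `A` of `x` with `K_x(A) = 1`. -/
def inputs (x : Ty) : Finset (Finset QSystem) :=
  x.ele.filter fun A => x.marksRight A % 2 = 1

/-- `out_x`: the other elementary types of `x`. -/
def outputs (x : Ty) : Finset (Finset QSystem) := x.ele \ x.inputs

end Ty

/-! ### Binary strings -/

/-- Binary strings labelled by the finite set `A`; `W_A` is `Finset.univ`. -/
abbrev Str (A : Finset (Finset QSystem)) : Type := A → Fin 2

/-- The string `e_A = 1 ⋯ 1`. -/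
def Str.ones (A : Finset (Finset QSystem)) : Str A := fun _ => 1

/-- `T_A = W_A \ {e_A}`. -/
def Str.nonOnes (A : Finset (Finset QSystem)) : Finset (Str A) :=
  Finset.univ \ {Str.ones A}

/-- The part of a string that is labelled by a subset. -/
def Str.restrict {A B : Finset (Finset QSystem)} (h : A ⊆ B) (w : Str B) : Str A :=
  fun i => w ⟨i.1, h i.2⟩

/-- The concatenation `J J'` of two sets of strings (with disjoint label sets). -/
def concat {A B : Finset (Finset QSystem)} (J : Finset (Str A)) (K : Finset (Str B)) :
    Finset (Str (A ∪ B)) :=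
  Finset.univ.filter fun w =>
    Str.restrict Finset.subset_union_left w ∈ J ∧ Str.restrict Finset.subset_union_right w ∈ K

namespace Ty

/-- The set of strings `D_x`: `D_A = {0}` for a non-trivial elementary type, `D_I = ∅` and
`D_{x → y} = W_x D_y ∪ (T_x \ D_x) (W_y \ D_y)`. -/
def strings : (x : Ty) → Finset (Str x.ele)
  | elem s => if s = ∅ then ∅ else {fun _ => 0}
  | arrow x y =>
      concat Finset.univ y.strings ∪
        concat (Str.nonOnes x.ele \ x.strings) (Finset.univ \ y.strings)

end Ty

/-! ### Contractions -/

/-- A pair `(A, A')` of equivalent elementary types: their Hilbert spaces have the same dimension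
and are identified by a bijection of their bases. -/
structure EquivPair where
  fst : Finset QSystem
  snd : Finset QSystem
  iso : Idx fst ≃ Idx snd

/-- The contraction `𝓒_{A,A'}(R) = R * Φ_{AA'} = ∑ k l, ⟨k k|R|l l⟩`, where
`Φ_{AA'} = ∑ k l, |k k⟩⟨l l|` is written in the identified bases of `A` and `A'`. -/
def contract {S : Finset QSystem} (p : EquivPair) (R : Op S) : Op (S \ (p.fst ∪ p.snd)) :=
  fun z w => ∑ k : Idx p.fst, ∑ l : Idx p.fst,
    R (glue S k (glue (S \ p.fst) (p.iso k) z)) (glue S l (glue (S \ p.fst) (p.iso l) w))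

/-- The systems that are left after contracting all pairs. -/
def remaining (S : Finset QSystem) : List EquivPair → Finset QSystem
  | [] => S
  | p :: H => remaining S H \ (p.fst ∪ p.snd)

/-- The multiple contraction `𝓒_H(R) = 𝓒_{A₁,A₁'}(𝓒_{A₂,A₂'}(⋯ 𝓒_{Aₙ,Aₙ'}(R) ⋯))` for
`H = [(A₁, A₁'), …, (Aₙ, Aₙ')]`. -/
def contractAll {S : Finset QSystem} : (H : List EquivPair) → Op S → Op (remaining S H)
  | [], R => R
  | p :: H, R => contract p (contractAll H R)

/-- The operator `R` on the systems `S` is a deterministic map of type `z`. -/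
def IsDeterministicOfType {S : Finset QSystem} (R : Op S) (z : Ty) : Prop :=
  ∃ h : S = z.systems, (h ▸ R : Op z.systems) ∈ z.deterministicMaps

/-- The contraction `𝓒_{A,A'}(x)` is admissible. -/
def ContractionAdmissible (x : Ty) (p : EquivPair) : Prop :=
  ∀ R ∈ x.deterministicMaps, ∃ z : Ty, z.Linear ∧ IsDeterministicOfType (contract p R) z

/-- The multiple contraction `𝓒_H(x)` is admissible. -/
def MultiContractionAdmissible (x : Ty) (H : List EquivPair) : Prop :=
  ∀ R ∈ x.deterministicMaps, ∃ z : Ty, z.Linear ∧ IsDeterministicOfType (contractAll H R) z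

/-- `in_H`: the inputs of `x` that are paired by `H` with some output of `x`. -/
def inH (x : Ty) (H : List EquivPair) : Finset (Finset QSystem) :=
  x.inputs.filter fun A => ∃ p ∈ H, p.fst = A ∧ p.snd ∈ x.outputs

/-- `out_H`: the outputs of `x` that are paired by `H` with some input of `x`. -/
def outH (x : Ty) (H : List EquivPair) : Finset (Finset QSystem) :=
  x.outputs.filter fun B => ∃ p ∈ H, p.snd = B ∧ p.fst ∈ x.inputs

theorem inputs_subset (x : Ty) : x.inputs ⊆ x.ele := Finset.filter_subset _ _

theorem outputs_subset (x : Ty) : x.outputs ⊆ x.ele := Finset.sdiff_subset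

theorem inH_subset (x : Ty) (H : List EquivPair) : inH x H ⊆ x.ele :=
  (Finset.filter_subset _ _).trans (inputs_subset x)

theorem outH_subset (x : Ty) (H : List EquivPair) : outH x H ⊆ x.ele :=
  (Finset.filter_subset _ _).trans (outputs_subset x)

/-- `S^x_{AB} = W_{in_x \ A} 0_A e_{out_x \ B} 0_B`, as a set of strings labelled by `Ele_x`. -/
def badStringsPair (x : Ty) (A B : Finset QSystem) : Finset (Str x.ele) :=
  Finset.univ.filter fun w =>
    (∀ h : A ∈ x.ele, w ⟨A, h⟩ = 0) ∧
    Str.restrict (Finset.sdiff_subset.trans (outputs_subset x)) w = Str.ones (x.outputs \ {B}) ∧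
    (∀ h : B ∈ x.ele, w ⟨B, h⟩ = 0)

/-- `S^x_H = ⋃ W_{in_x \ in_H} b e_{out_x \ out_H} b'`, as a set of strings labelled by `Ele_x`;
the union is over the strings `b ∈ T_{in_H}`, `b' ∈ T_{out_H}` with `b_A = b'_{A'}` for all
`(A, A') ∈ H`. -/
def badStrings (x : Ty) (H : List EquivPair) : Finset (Str x.ele) :=
  Finset.univ.filter fun w =>
    ∃ b ∈ Str.nonOnes (inH x H), ∃ c ∈ Str.nonOnes (outH x H),
      (∀ p ∈ H, ∀ (h : p.fst ∈ inH x H) (k : p.snd ∈ outH x H), b ⟨p.fst, h⟩ = c ⟨p.snd, k⟩) ∧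
      Str.restrict (inH_subset x H) w = b ∧
      Str.restrict (Finset.sdiff_subset.trans (outputs_subset x)) w =
        Str.ones (x.outputs \ outH x H) ∧
      Str.restrict (outH_subset x H) w = c

end HigherOrder

-- Expand an operator in tensor products in which every system carries either the identity or a
-- traceless factor; the support of a term is the set `U` of systems with a traceless factor. A zero
-- in a string marks an elementary type met by `U`, and `strOf_mem_strings` identifies membership in
-- `D_x` with `Ty.good`.
--
-- The recursive definition collapses to linear conditions (`maps_eq`): the deterministic maps of
-- type `x` are exactly the positive operators with trace equal to the dimension of the inputs and
-- with no component whose support is nonempty and not good. Admissible maps are the positive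
-- operators dominated by deterministic ones. In particular the normalized identity is
-- deterministic, and so is any small Hermitian traceless perturbation of it by good components.
--
-- Contracting a pair kills a product term when its support meets exactly one member of the pair,
-- because the identity on one side turns the contraction into a trace on the other. Thus a good
-- term can spoil normalization only if it meets some pair, meets both or neither member of each
-- pair, and misses all uncontracted outputs. These supports (`Obstructs`) are the strings of
-- `S^x_H`. If none is good, every contraction is a channel from the remaining inputs to the
-- remaining outputs (`isDet_contractAll`).
--
-- Conversely, a good obstruction yields a perturbation `T` that survives contraction and whose
-- contracted support avoids the remaining outputs (`exists_obstruction`). If that support is empty,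
-- a small multiple of `T` gives the contracted operator a non-integer trace, whereas deterministic
-- maps of any type have integer trace. Otherwise single-system components are also added on all
-- remaining outputs. A type `z` of the result must then have all of these, and also some remaining
-- input, among its outputs, so its input dimension is strictly smaller than the trace
-- (`not_obstructs_of_multiContractionAdmissible`).

namespace HigherOrder

open scoped ComplexOrder

/-! ### Positive matrices -/

section PosSemidef

variable {ι κ : Type*} [Fintype ι] [Fintype κ]

/-- This is the congruence `Vᴴ B V` with `V` sending `|w⟩` to `∑ a, |a, w⟩`. Both the action of Choi
operators and the contraction have this form. -/
theorem posSemidef_sum_sum [DecidableEq κ] {B : Matrix (ι × κ) (ι × κ) ℂ} (hB : B.PosSemidef) :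
    (Matrix.of fun z w => ∑ a, ∑ b, B (a, z) (b, w)).PosSemidef := by
  have h := hB.conjTranspose_mul_mul_same
    (Matrix.of fun (p : ι × κ) (w : κ) => if p.2 = w then (1 : ℂ) else 0)
  convert h using 1
  ext z w
  simp only [Matrix.mul_apply, Matrix.conjTranspose_apply, Matrix.of_apply, Fintype.sum_prod_type,
    apply_ite (star : ℂ → ℂ), star_one, star_zero, ite_mul, one_mul, zero_mul, mul_ite, mul_one,
    mul_zero, Finset.sum_ite_eq', Finset.mem_univ, if_true]
  exact Finset.sum_comm

open scoped Matrix.Norms.L2Operator MatrixOrder in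
theorem exists_smul_one_add_posSemidef [DecidableEq ι] {H : Matrix ι ι ℂ} (hH : H.IsHermitian) :
    ∃ C : ℝ, 0 ≤ C ∧ ((C : ℂ) • (1 : Matrix ι ι ℂ) + H).PosSemidef := by
  refine ⟨‖H‖, norm_nonneg _, ?_⟩
  have h := IsSelfAdjoint.neg_algebraMap_norm_le_self (a := H) hH
  rw [Matrix.le_iff] at h
  have e : H - -(algebraMap ℝ (Matrix ι ι ℂ)) ‖H‖ = ((‖H‖ : ℝ) : ℂ) • (1 : Matrix ι ι ℂ) + H := by
    rw [sub_neg_eq_add, add_comm, Algebra.algebraMap_eq_smul_one]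
    congr 1
  rwa [e] at h

/-- A positive multiple of the identity is interior to the positive cone, so small Hermitian
perturbations remain positive. All test operators below arise in this way. -/
theorem exists_smul_one_add_smul_posSemidef [DecidableEq ι] {H : Matrix ι ι ℂ}
    (hH : H.IsHermitian) {c : ℝ} (hc : 0 < c) :
    ∃ r : ℝ, 0 < r ∧ ∀ s : ℝ, 0 ≤ s → s ≤ r →
      ((c : ℂ) • (1 : Matrix ι ι ℂ) + (s : ℂ) • H).PosSemidef := by
  obtain ⟨C, hC, h⟩ := exists_smul_one_add_posSemidef hH
  -- The `+ 1` keeps the denominator positive when `C = 0`; only `s * C ≤ c` is needed.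
  refine ⟨c / (C + 1), by positivity, fun s hs hsr => ?_⟩
  have h1 : 0 ≤ c - s * C := by
    rw [le_div_iff₀ (by positivity)] at hsr
    nlinarith
  have h2 : ((c : ℂ) • (1 : Matrix ι ι ℂ) + (s : ℂ) • H) =
      (s : ℂ) • ((C : ℂ) • (1 : Matrix ι ι ℂ) + H) + ((c - s * C : ℝ) : ℂ) • 1 := by
    push_cast
    module
  rw [h2]
  exact (h.smul (by exact_mod_cast hs)).add (Matrix.PosSemidef.one.smul (by exact_mod_cast h1))

end PosSemidef

/-! ### Sums over composite basis labels -/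

theorem glue_of_mem {X Z Q : Finset QSystem} (a : Idx X) (z : Idx Z) (i : Q) (h : i.1 ∈ X) :
    glue Q a z i = a ⟨i.1, h⟩ := by
  simp [glue, h]

theorem glue_of_notMem {X Z Q : Finset QSystem} (a : Idx X) (z : Idx Z) (i : Q) (h : i.1 ∉ X)
    (h' : i.1 ∈ Z) : glue Q a z i = z ⟨i.1, h'⟩ := by
  simp [glue, h, h']

/-- A basis label of a composite system is a pair of basis labels of its parts. -/
def glueEquiv {S A B : Finset QSystem} (hS : S = A ∪ B) (hd : Disjoint A B) :
    Idx A × Idx B ≃ Idx S where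
  toFun p := glue S p.1 p.2
  invFun q := (fun i => q ⟨i.1, by rw [hS]; exact Finset.mem_union_left _ i.2⟩,
    fun i => q ⟨i.1, by rw [hS]; exact Finset.mem_union_right _ i.2⟩)
  left_inv p := by
    ext i
    · simp [glue]
    · simp [glue, Finset.disjoint_right.mp hd i.2]
  right_inv q := by
    ext i
    have hi := i.2
    simp only [hS, Finset.mem_union] at hi
    by_cases h : i.1 ∈ A
    · simp [glue, h]
    · simp [glue, h, hi.resolve_left h]

theorem sum_glue {S A B : Finset QSystem} (hS : S = A ∪ B) (hd : Disjoint A B) {M : Type*}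
    [AddCommMonoid M] (f : Idx S → M) : ∑ q, f q = ∑ a : Idx A, ∑ b : Idx B, f (glue S a b) := by
  rw [← Fintype.sum_prod_type', ← (glueEquiv hS hd).sum_comp]
  rfl

theorem glue_glue {X Y E P Z : Finset QSystem} (hP : P ⊆ X ∪ Y) (hY : Y ⊆ Z)
    (a : Idx X) (y : Idx Y) (e : Idx E) : glue P a (glue Z y e) = glue P a y := by
  funext i
  by_cases h : i.1 ∈ X
  · simp [glue, h]
  · have hi : i.1 ∈ Y := (Finset.mem_union.mp (hP i.2)).resolve_left h
    simp [glue, h, hi, hY hi]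

theorem glue_glue_right {X Y E Q Z : Finset QSystem} (hQ : Q ⊆ X ∪ E) (hE : E ⊆ Z)
    (hd : Disjoint Y E) (a : Idx X) (y : Idx Y) (e : Idx E) :
    glue Q a (glue Z y e) = glue Q a e := by
  funext i
  by_cases h : i.1 ∈ X
  · simp [glue, h]
  · have hi : i.1 ∈ E := (Finset.mem_union.mp (hQ i.2)).resolve_left h
    simp [glue, h, hi, hE hi, Finset.disjoint_right.mp hd hi]

/-! ### Product operators -/

/-- A family of operators, one on every system. -/
abbrev Fam : Type := ∀ q : QSystem, Matrix (Fin q.dim) (Fin q.dim) ℂ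

/-- The tensor product over `S` of a family of operators. -/
def prodOp (K : Fam) (S : Finset QSystem) : Op S := fun a b => ∏ i : S, K i.1 (a i) (b i)

/-- The bilinear pairing `∑ a b, ⟨a|K|b⟩⟨a|R|b⟩` of a product operator with an operator. -/
def pair (K : Fam) {S : Finset QSystem} (R : Op S) : ℂ :=
  ∑ a : Idx S, ∑ b : Idx S, prodOp K S a b * R a b

/-- The family is traceless on the systems of `U` and trivial on the other systems. -/
def Adapted (K : Fam) (U : Finset QSystem) : Prop :=
  (∀ q ∈ U, (K q).trace = 0) ∧ ∀ q ∉ U, K q = 1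

/-- The family that agrees with `K` on `X` and with `L` on the other systems. -/
def mix (X : Finset QSystem) (K L : Fam) : Fam := fun q => if q ∈ X then K q else L q

/-- The operator obtained by pairing the part of `R` on `E` with a product operator. -/
def partialPair (K : Fam) (X E : Finset QSystem) {Q : Finset QSystem} (R : Op Q) : Op X :=
  fun a b => ∑ e : Idx E, ∑ f : Idx E, prodOp K E e f * R (glue Q a e) (glue Q b f)

theorem prodOp_congr {K L : Fam} {S : Finset QSystem} (h : ∀ q ∈ S, K q = L q) :
    prodOp K S = prodOp L S := by
  ext a b
  exact Finset.prod_congr rfl fun i _ => by rw [h i.1 i.2]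

theorem pair_congr {K L : Fam} {S : Finset QSystem} (h : ∀ q ∈ S, K q = L q) (R : Op S) :
    pair K R = pair L R := by
  simp only [pair, prodOp_congr h]

theorem prodOp_one (S : Finset QSystem) : prodOp 1 S = 1 := by
  ext a b
  by_cases h : a = b
  · subst h
    simp [prodOp]
  · obtain ⟨i, hi⟩ := Function.ne_iff.mp h
    rw [Matrix.one_apply_ne h]
    exact Finset.prod_eq_zero (Finset.mem_univ i) (by simp [hi])

theorem conjTranspose_prodOp (K : Fam) (S : Finset QSystem) :
    (prodOp K S).conjTranspose = prodOp (fun q => (K q).conjTranspose) S := by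
  ext a b
  simp [prodOp, Matrix.conjTranspose_apply]

theorem Adapted.conjTranspose {K : Fam} {U : Finset QSystem} (hK : Adapted K U) :
    Adapted (fun q => (K q).conjTranspose) U :=
  ⟨fun q hq => by simp [Matrix.trace_conjTranspose, hK.1 q hq], fun q hq => by simp [hK.2 q hq]⟩

theorem adapted_one : Adapted 1 ∅ := by simp [Adapted]

theorem Adapted.eq_one_of_disjoint {K : Fam} {U S : Finset QSystem} (h : Adapted K U)
    (hd : Disjoint U S) : prodOp K S = 1 := by
  rw [← prodOp_one]
  exact prodOp_congr fun q hq => h.2 q (Finset.disjoint_right.mp hd hq)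

theorem prodOp_glue (K : Fam) {S A B : Finset QSystem} (hS : S = A ∪ B) (hd : Disjoint A B)
    (a a' : Idx A) (b b' : Idx B) :
    prodOp K S (glue S a b) (glue S a' b') = prodOp K A a a' * prodOp K B b b' := by
  have key : ∀ (T : Finset QSystem) (c c' : Idx T) (f : QSystem → ℂ),
      (∀ i : T, f i.1 = K i.1 (c i) (c' i)) → prodOp K T c c' = ∏ q ∈ T, f q := by
    intro T c c' f hf
    rw [← Finset.prod_coe_sort]
    exact Finset.prod_congr rfl fun i _ => (hf i).symm
  let f : QSystem → ℂ := fun q =>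
    if h : q ∈ S then K q (glue S a b ⟨q, h⟩) (glue S a' b' ⟨q, h⟩) else 0
  rw [key S _ _ f (fun i => by simp [f]), key A a a' f, key B b b' f, hS, Finset.prod_union hd]
  · intro i
    have h1 : i.1 ∈ S := by rw [hS]; exact Finset.mem_union_right _ i.2
    have h2 := Finset.disjoint_right.mp hd i.2
    simp [f, h1, glue, h2]
  · intro i
    have h1 : i.1 ∈ S := by rw [hS]; exact Finset.mem_union_left _ i.2
    simp [f, h1, glue]

theorem sum_prodOp (K : Fam) (S : Finset QSystem) :
    ∑ a : Idx S, ∑ b : Idx S, prodOp K S a b = ∏ i : S, ∑ a, ∑ b, K i.1 a b := by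
  have h : ∀ a : Idx S, ∑ b : Idx S, prodOp K S a b = ∏ i : S, ∑ b, K i.1 (a i) b := by
    intro a
    rw [Finset.prod_univ_sum, Fintype.piFinset_univ]
    rfl
  simp only [h]
  rw [Finset.prod_univ_sum, Fintype.piFinset_univ]

theorem trace_prodOp (K : Fam) (S : Finset QSystem) :
    (prodOp K S).trace = ∏ q ∈ S, (K q).trace := by
  rw [← Finset.prod_coe_sort]
  simp only [Matrix.trace, Matrix.diag]
  rw [Finset.prod_univ_sum, Fintype.piFinset_univ]
  rfl

theorem pair_prodOp (K L : Fam) (S : Finset QSystem) :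
    pair K (prodOp L S) = ∏ q ∈ S, ∑ a, ∑ b, K q a b * L q a b := by
  rw [← Finset.prod_coe_sort]
  exact Eq.trans (by simp only [pair, prodOp, ← Finset.prod_mul_distrib])
    (sum_prodOp (fun q a b => K q a b * L q a b) S)

theorem pair_one_left {S : Finset QSystem} (R : Op S) : pair 1 R = R.trace := by
  simp only [pair, prodOp_one, Matrix.one_apply, ite_mul, one_mul, zero_mul, Finset.sum_ite_eq,
    Finset.mem_univ, if_true]
  rfl

theorem pair_one_right (K : Fam) (S : Finset QSystem) :
    pair K (1 : Op S) = ∏ q ∈ S, (K q).trace := by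
  rw [← prodOp_one, pair_prodOp]
  refine Finset.prod_congr rfl fun q _ => ?_
  simp [Matrix.one_apply, Matrix.trace]

theorem pair_add (K : Fam) {S : Finset QSystem} (R T : Op S) :
    pair K (R + T) = pair K R + pair K T := by
  simp [pair, mul_add, Finset.sum_add_distrib]

theorem pair_smul (K : Fam) {S : Finset QSystem} (c : ℂ) (R : Op S) :
    pair K (c • R) = c * pair K R := by
  simp only [pair, Finset.mul_sum, Matrix.smul_apply, smul_eq_mul]
  exact Finset.sum_congr rfl fun a _ => Finset.sum_congr rfl fun b _ => by ring

theorem pair_sum (K : Fam) {S : Finset QSystem} {ι : Type*} (s : Finset ι) (R : ι → Op S) :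
    pair K (∑ i ∈ s, R i) = ∑ i ∈ s, pair K (R i) := by
  classical
  induction s using Finset.induction_on with
  | empty => simp [pair]
  | insert i s hi ih => rw [Finset.sum_insert hi, Finset.sum_insert hi, pair_add, ih]

/-- Product operators of different support are orthogonal. -/
theorem pair_prodOp_eq_zero {K L : Fam} {U V S : Finset QSystem} (hK : Adapted K U)
    (hL : Adapted L V) (h : ∃ q ∈ S, ¬ (q ∈ U ↔ q ∈ V)) : pair K (prodOp L S) = 0 := by
  obtain ⟨q, hq, hne⟩ := h
  rw [pair_prodOp]
  refine Finset.prod_eq_zero hq ?_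
  by_cases hU : q ∈ U
  · have hV : q ∉ V := fun h => hne (by simp [hU, h])
    simpa [hL.2 q hV, Matrix.one_apply, Matrix.trace] using hK.1 q hU
  · have hV : q ∈ V := by
      by_contra h
      exact hne (by simp [hU, h])
    simpa [hK.2 q hU, Matrix.one_apply, Matrix.trace] using hL.1 q hV

theorem pair_partialPair (K L : Fam) {X E Q : Finset QSystem} (hQ : Q = X ∪ E)
    (hd : Disjoint X E) (R : Op Q) : pair K (partialPair L X E R) = pair (mix X K L) R := by
  simp only [pair, partialPair]
  rw [sum_glue hQ hd]
  have h : ∀ a : Idx X, ∀ e : Idx E,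
      ∑ b : Idx Q, prodOp (mix X K L) Q (glue Q a e) b * R (glue Q a e) b =
        ∑ b : Idx X, ∑ f : Idx E, prodOp (mix X K L) X a b * prodOp (mix X K L) E e f *
          R (glue Q a e) (glue Q b f) := by
    intro a e
    rw [sum_glue hQ hd]
    simp only [prodOp_glue (mix X K L) hQ hd]
  simp only [h]
  rw [show prodOp (mix X K L) X = prodOp K X from prodOp_congr fun q hq => by simp [mix, hq],
    show prodOp (mix X K L) E = prodOp L E from
      prodOp_congr fun q hq => by simp [mix, Finset.disjoint_right.mp hd hq]]
  refine Finset.sum_congr rfl fun a _ => ?_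
  simp only [Finset.mul_sum]
  rw [Finset.sum_comm]
  refine Finset.sum_congr rfl fun e _ => ?_
  exact Finset.sum_congr rfl fun b _ => Finset.sum_congr rfl fun f _ => by ring

theorem partialPair_prodOp (K L : Fam) {X E Q : Finset QSystem} (hQ : Q = X ∪ E)
    (hd : Disjoint X E) :
    partialPair K X E (prodOp L Q) = pair K (prodOp L E) • prodOp L X := by
  ext a b
  simp only [partialPair, prodOp_glue L hQ hd, pair, Matrix.smul_apply, smul_eq_mul,
    Finset.sum_mul]
  exact Finset.sum_congr rfl fun e _ => Finset.sum_congr rfl fun f _ => by ring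

/-! ### A product basis of the operators -/

/-- The identity together with the traceless parts of the matrix units. -/
noncomputable def basisMat (d : ℕ) : Option (Fin d × Fin d) → Matrix (Fin d) (Fin d) ℂ
  | none => 1
  | some p => Matrix.single p.1 p.2 1 - ((if p.1 = p.2 then 1 else 0 : ℂ) / d) • 1

/-- The normalization of `basisMat`. -/
noncomputable def basisWeight (d : ℕ) : Option (Fin d × Fin d) → ℂ
  | none => 1 / d
  | some _ => 1

theorem trace_basisMat {d : ℕ} (hd : d ≠ 0) (p : Fin d × Fin d) :
    (basisMat d (some p)).trace = 0 := by
  have h : (d : ℂ) ≠ 0 := by exact_mod_cast hd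
  by_cases hp : p.1 = p.2
  · simp [basisMat, hp, h]
  · simp [basisMat, hp]

/-- The family has `d ^ 2 + 1` members, so it is overcomplete rather than a basis. The identity with
weight `1 / d` resolves the scalar part and the traceless parts of the matrix units resolve the
complement. This completeness is all that the expansions use. -/
theorem sum_basisMat {d : ℕ} (hd : d ≠ 0) (a b a' b' : Fin d) :
    ∑ k, basisWeight d k * (basisMat d k a b * basisMat d k a' b') =
      if a = a' ∧ b = b' then 1 else 0 := by
  have h : (d : ℂ) ≠ 0 := by exact_mod_cast hd
  rw [Fintype.sum_option, Fintype.sum_prod_type]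
  simp only [basisMat, basisWeight, Matrix.sub_apply, Matrix.single_apply, Matrix.smul_apply,
    smul_eq_mul, sub_mul, mul_sub, Finset.sum_sub_distrib, one_mul]
  have e1 : ∀ x y x' y' : Fin d, (∑ c : Fin d, ∑ e : Fin d, (if c = x ∧ e = y then (1 : ℂ) else 0) *
      (if c = x' ∧ e = y' then 1 else 0)) = if x = x' ∧ y = y' then 1 else 0 := by
    intro x y x' y'
    simp only [ite_and, ite_mul, one_mul, zero_mul, Finset.sum_ite_eq', Finset.mem_univ, if_true,
      Finset.sum_ite_irrel, Finset.sum_const_zero]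
  have e2 : ∀ x y x' y' : Fin d, (∑ c : Fin d, ∑ e : Fin d, (if c = x ∧ e = y then (1 : ℂ) else 0) *
      ((if c = e then 1 else 0) / d * (1 : Matrix (Fin d) (Fin d) ℂ) x' y')) =
        1 / d * ((1 : Matrix (Fin d) (Fin d) ℂ) x y * (1 : Matrix (Fin d) (Fin d) ℂ) x' y') := by
    intro x y x' y'
    simp only [ite_and, ite_mul, one_mul, zero_mul, Finset.sum_ite_eq', Finset.mem_univ, if_true,
      Finset.sum_ite_irrel, Finset.sum_const_zero, Matrix.one_apply]
    split_ifs <;> simp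
  have e3 : (∑ c : Fin d, ∑ e : Fin d, ((if c = e then (1 : ℂ) else 0) / d *
      (1 : Matrix (Fin d) (Fin d) ℂ) a b) * ((if c = e then 1 else 0) / d *
        (1 : Matrix (Fin d) (Fin d) ℂ) a' b')) =
        1 / d * ((1 : Matrix (Fin d) (Fin d) ℂ) a b * (1 : Matrix (Fin d) (Fin d) ℂ) a' b') := by
    have : ∀ c e : Fin d, ((if c = e then (1 : ℂ) else 0) / d *
      (1 : Matrix (Fin d) (Fin d) ℂ) a b) * ((if c = e then 1 else 0) / d *
        (1 : Matrix (Fin d) (Fin d) ℂ) a' b') = if c = e then 1 / d * (1 / d) *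
        ((1 : Matrix (Fin d) (Fin d) ℂ) a b * (1 : Matrix (Fin d) (Fin d) ℂ) a' b') else 0 := by
      intro c e
      split_ifs <;> simp
      ring
    simp only [this, Finset.sum_ite_eq, Finset.mem_univ, if_true, Finset.sum_const,
      Finset.card_univ, Fintype.card_fin, nsmul_eq_mul]
    field_simp
  have e4 : (∑ c : Fin d, ∑ e : Fin d, ((if c = e then (1 : ℂ) else 0) / d *
      (1 : Matrix (Fin d) (Fin d) ℂ) a b) * (if c = a' ∧ e = b' then 1 else 0)) =
        1 / d * ((1 : Matrix (Fin d) (Fin d) ℂ) a b * (1 : Matrix (Fin d) (Fin d) ℂ) a' b') := by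
    rw [mul_comm ((1 : Matrix (Fin d) (Fin d) ℂ) a b), ← e2]
    exact Finset.sum_congr rfl fun _ _ => Finset.sum_congr rfl fun _ _ => mul_comm _ _
  rw [e1, e2, e3, e4]
  ring

/-- Labels of the product basis of `Op S`. -/
abbrev BasisIdx (S : Finset QSystem) : Type := ∀ i : S, Option (Fin i.1.dim × Fin i.1.dim)

/-- The elements of the product basis, as families. -/
noncomputable def basisFam {S : Finset QSystem} (k : BasisIdx S) : Fam := fun q =>
  if h : q ∈ S then basisMat q.dim (k ⟨q, h⟩) else 1

/-- The systems on which an element of the product basis is traceless. -/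
def basisSupp {S : Finset QSystem} (k : BasisIdx S) : Finset QSystem :=
  S.filter fun q => ∃ h : q ∈ S, k ⟨q, h⟩ ≠ none

/-- The normalization of the product basis. -/
noncomputable def basisCoeff {S : Finset QSystem} (k : BasisIdx S) : ℂ :=
  ∏ i, basisWeight i.1.dim (k i)

theorem QSystem.dim_ne_zero (q : QSystem) : q.dim ≠ 0 := by
  have := q.two_le
  omega

theorem basisSupp_subset {S : Finset QSystem} (k : BasisIdx S) : basisSupp k ⊆ S :=
  Finset.filter_subset _ _

theorem adapted_basisFam {S : Finset QSystem} (k : BasisIdx S) :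
    Adapted (basisFam k) (basisSupp k) := by
  constructor
  · intro q hq
    obtain ⟨-, hS, hk⟩ := Finset.mem_filter.mp hq
    obtain ⟨p, hp⟩ := Option.ne_none_iff_exists'.mp hk
    simp [basisFam, hS, hp, trace_basisMat q.dim_ne_zero]
  · intro q hq
    by_cases hS : q ∈ S
    · have : k ⟨q, hS⟩ = none := by
        by_contra h
        exact hq (Finset.mem_filter.mpr ⟨hS, hS, h⟩)
      simp [basisFam, hS, this, basisMat]
    · simp [basisFam, hS]

theorem basisFam_none (S : Finset QSystem) : basisFam (fun _ => none : BasisIdx S) = 1 := by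
  funext q
  simp [basisFam, basisMat]

theorem basisCoeff_none (S : Finset QSystem) :
    basisCoeff (fun _ => none : BasisIdx S) = 1 / ((∏ q ∈ S, q.dim : ℕ) : ℂ) := by
  simp only [basisCoeff, basisWeight]
  rw [Finset.prod_coe_sort S (fun q => 1 / (q.dim : ℂ))]
  simp

theorem basisSupp_nonempty {S : Finset QSystem} {k : BasisIdx S} (hk : k ≠ fun _ => none) :
    (basisSupp k).Nonempty := by
  obtain ⟨i, hi⟩ := Function.ne_iff.mp hk
  exact ⟨i.1, Finset.mem_filter.mpr ⟨i.2, i.2, hi⟩⟩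

theorem sum_prodOp_basisFam {S : Finset QSystem} (a b a' b' : Idx S) :
    ∑ k : BasisIdx S, basisCoeff k * (prodOp (basisFam k) S a b * prodOp (basisFam k) S a' b') =
      if a = a' ∧ b = b' then 1 else 0 := by
  have h : ∀ k : BasisIdx S,
      basisCoeff k * (prodOp (basisFam k) S a b * prodOp (basisFam k) S a' b') =
        ∏ i : S, (basisWeight i.1.dim (k i) *
          (basisMat i.1.dim (k i) (a i) (b i) * basisMat i.1.dim (k i) (a' i) (b' i))) := by
    intro k
    simp only [basisCoeff, prodOp, ← Finset.prod_mul_distrib]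
    exact Finset.prod_congr rfl fun i _ => by simp [basisFam]
  simp only [h]
  have h2 := Finset.prod_univ_sum
    (fun i : S => (Finset.univ : Finset (Option (Fin i.1.dim × Fin i.1.dim))))
    (fun i j => basisWeight i.1.dim j *
          (basisMat i.1.dim j (a i) (b i) * basisMat i.1.dim j (a' i) (b' i)))
  rw [Fintype.piFinset_univ] at h2
  rw [← h2]
  simp only [sum_basisMat (QSystem.dim_ne_zero _)]
  rw [Finset.prod_ite_zero]
  simp [funext_iff, forall_and]

/-- Parseval's identity for the bilinear form, obtained by inserting the completeness relation of
the product family. -/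
theorem sum_mul_eq_sum_basisFam {S : Finset QSystem} (R M : Op S) :
    ∑ a, ∑ b, R a b * M a b =
      ∑ k : BasisIdx S, basisCoeff k * (pair (basisFam k) R * pair (basisFam k) M) := by
  have h : ∀ k : BasisIdx S, basisCoeff k * (pair (basisFam k) R * pair (basisFam k) M) =
      ∑ p : (Idx S × Idx S) × (Idx S × Idx S), (basisCoeff k *
        (prodOp (basisFam k) S p.1.1 p.1.2 * prodOp (basisFam k) S p.2.1 p.2.2)) *
          (R p.1.1 p.1.2 * M p.2.1 p.2.2) := by
    intro k
    have h1 : ∀ T : Op S, pair (basisFam k) T =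
        ∑ p : Idx S × Idx S, prodOp (basisFam k) S p.1 p.2 * T p.1 p.2 := fun T =>
      (Fintype.sum_prod_type' fun a b => prodOp (basisFam k) S a b * T a b).symm
    rw [h1, h1, Finset.sum_mul_sum, ← Fintype.sum_prod_type', Finset.mul_sum]
    exact Finset.sum_congr rfl fun p _ => by ring
  simp only [h]
  symm
  rw [Finset.sum_comm]
  have h2 : ∀ p : (Idx S × Idx S) × (Idx S × Idx S), ∑ k : BasisIdx S, (basisCoeff k *
        (prodOp (basisFam k) S p.1.1 p.1.2 * prodOp (basisFam k) S p.2.1 p.2.2)) *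
          (R p.1.1 p.1.2 * M p.2.1 p.2.2) =
      (if p.1.1 = p.2.1 ∧ p.1.2 = p.2.2 then 1 else 0) * (R p.1.1 p.1.2 * M p.2.1 p.2.2) := by
    intro p
    rw [← Finset.sum_mul, sum_prodOp_basisFam]
  rw [Finset.sum_congr rfl fun p _ => h2 p, Fintype.sum_prod_type,
    ← Fintype.sum_prod_type' fun a b => R a b * M a b]
  refine Finset.sum_congr rfl fun p _ => ?_
  rw [Finset.sum_eq_single p]
  · simp
  · rintro q - hq
    rw [if_neg, zero_mul]
    rintro ⟨h1, h2⟩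
    exact hq (Prod.ext h1.symm h2.symm)
  · simp

theorem eq_sum_basisFam {S : Finset QSystem} (R : Op S) :
    R = ∑ k : BasisIdx S, (basisCoeff k * pair (basisFam k) R) • prodOp (basisFam k) S := by
  ext a b
  have h := sum_mul_eq_sum_basisFam R (Matrix.single a b 1)
  have h1 : ∀ T : Op S, ∑ a', ∑ b', T a' b' * (Matrix.single a b 1 : Op S) a' b' = T a b := by
    intro T
    simp [Matrix.single_apply, ite_and]
  rw [h1] at h
  rw [h, Matrix.sum_apply]
  refine Finset.sum_congr rfl fun k _ => ?_
  rw [pair.eq_def _ (Matrix.single a b 1), h1, Matrix.smul_apply, smul_eq_mul]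
  ring

/-! ### Inputs and outputs on the level of systems -/

namespace Ty

/-- Operators of type `x` may have a component that is traceless exactly on `U`. -/
def good : Ty → Finset QSystem → Prop
  | elem s, U => ¬ Disjoint U s
  | arrow x y, U => y.good U ∨ (¬ Disjoint U x.systems ∧ ¬ x.good U)

mutual
/-- The systems that are inputs of the maps of a type. -/
def inSys : Ty → Finset QSystem
  | elem _ => ∅
  | arrow x y => x.outSys ∪ y.inSys

/-- The systems that are outputs of the maps of a type. -/
def outSys : Ty → Finset QSystem
  | elem s => s
  | arrow x y => x.inSys ∪ y.outSys
end

theorem systems_eq (x : Ty) : x.systems = x.inSys ∪ x.outSys := by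
  induction x with
  | elem s => simp [systems, inSys, outSys]
  | arrow x y hx hy =>
    simp only [systems, inSys, outSys, hx, hy]
    ext q
    simp only [Finset.mem_union]
    tauto

theorem inSys_subset (x : Ty) : x.inSys ⊆ x.systems := by
  rw [systems_eq]; exact Finset.subset_union_left

theorem outSys_subset (x : Ty) : x.outSys ⊆ x.systems := by
  rw [systems_eq]; exact Finset.subset_union_right

theorem Linear.disjoint_inSys_outSys {x : Ty} (h : x.Linear) : Disjoint x.inSys x.outSys := by
  induction x with
  | elem s => simp [inSys]
  | arrow x y hx hy =>
    obtain ⟨h1, h2, h3⟩ := h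
    have i1 := Finset.disjoint_left.mp (hx h1)
    have i2 := Finset.disjoint_left.mp (hy h2)
    have i3 := Finset.disjoint_left.mp h3
    rw [Finset.disjoint_left]
    simp only [inSys, outSys, Finset.mem_union]
    rintro q (h | h) (h' | h')
    · exact i1 h' h
    · exact i3 (outSys_subset _ h) (outSys_subset _ h')
    · exact i3 (inSys_subset _ h') (inSys_subset _ h)
    · exact i2 h h'

theorem systems_ext (x : Ty) (E : Finset QSystem) : (x.ext E).systems = x.systems ∪ E := by
  induction x with
  | elem s => rfl
  | arrow x y _ hy => simp only [ext, systems, hy, Finset.union_assoc]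

theorem inSys_ext (x : Ty) (E : Finset QSystem) : (x.ext E).inSys = x.inSys := by
  induction x with
  | elem s => simp [ext, inSys]
  | arrow x y _ hy => simp only [ext, inSys, hy]

theorem Linear.ext {x : Ty} (h : x.Linear) {E : Finset QSystem} (hE : Disjoint E x.systems) :
    (x.ext E).Linear := by
  induction x with
  | elem s => trivial
  | arrow x y _ hy =>
    obtain ⟨h1, h2, h3⟩ := h
    rw [systems, Finset.disjoint_union_right] at hE
    refine ⟨h1, hy h2 hE.2, ?_⟩
    rw [systems_ext, Finset.disjoint_union_right]
    exact ⟨h3, hE.1.symm⟩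

theorem good_ext (x : Ty) (E U : Finset QSystem) :
    (x.ext E).good U ↔ ¬ Disjoint U E ∨ x.good U := by
  induction x with
  | elem s =>
    simp only [Ty.ext, good, Finset.disjoint_union_right]
    tauto
  | arrow x y _ hy =>
    simp only [Ty.ext, good, hy]
    tauto

theorem good_congr {x : Ty} {U V : Finset QSystem} (h : U ∩ x.systems = V ∩ x.systems) :
    x.good U ↔ x.good V := by
  have key : ∀ {S T : Finset QSystem}, S ⊆ T → U ∩ T = V ∩ T → U ∩ S = V ∩ S := by
    intro S T hST h
    rw [← Finset.inter_eq_right.mpr hST, ← Finset.inter_assoc, h, Finset.inter_assoc]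
  induction x with
  | elem s =>
    simp only [good, Finset.disjoint_iff_inter_eq_empty]
    rw [show U ∩ s = V ∩ s from h]
  | arrow x y hx hy =>
    have h1 := key (T := (arrow x y).systems) Finset.subset_union_left h
    have h2 := key (T := (arrow x y).systems) Finset.subset_union_right h
    simp only [good, hx h1, hy h2, Finset.disjoint_iff_inter_eq_empty, h1]

theorem not_good_of_disjoint {x : Ty} {U : Finset QSystem} (h : Disjoint U x.systems) :
    ¬ x.good U := by
  induction x with
  | elem s => exact not_not_intro h
  | arrow x y hx hy =>
    rw [systems, Finset.disjoint_union_right] at h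
    simp [good, h.1, hy h.2]

/-- Components that are traceless on some output and trivial on all inputs are allowed, whereas
components that are trivial on all outputs are not. -/
theorem good_of_disjoint_and_not_good {x : Ty} (U : Finset QSystem) :
    (Disjoint U x.inSys → ¬ Disjoint U x.outSys → x.good U) ∧
      (Disjoint U x.outSys → ¬ x.good U) := by
  induction x with
  | elem s => simp [good, outSys]
  | arrow x y hx hy =>
    simp only [good, inSys, outSys, Finset.disjoint_union_right]
    rw [x.systems_eq, Finset.disjoint_union_right]
    tauto

/-- The dimension of the input systems. -/
def inDim (x : Ty) : ℕ := ∏ q ∈ x.inSys, q.dim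

/-- The dimension of the output systems. -/
def outDim (x : Ty) : ℕ := ∏ q ∈ x.outSys, q.dim

theorem prod_dim_ne_zero (S : Finset QSystem) : ∏ q ∈ S, q.dim ≠ 0 :=
  Finset.prod_ne_zero_iff.mpr fun q _ => q.dim_ne_zero

theorem outDim_ne_zero (x : Ty) : (x.outDim : ℂ) ≠ 0 :=
  Nat.cast_ne_zero.mpr (prod_dim_ne_zero _)

theorem Linear.prod_dim {x : Ty} (h : x.Linear) : ∏ q ∈ x.systems, q.dim = x.inDim * x.outDim := by
  rw [systems_eq, Finset.prod_union h.disjoint_inSys_outSys]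
  rfl

theorem Linear.inDim_arrow {x y : Ty} (h : (arrow x y).Linear) :
    (arrow x y).inDim = x.outDim * y.inDim := by
  rw [inDim, inSys, Finset.prod_union (h.2.2.mono x.outSys_subset y.inSys_subset)]
  rfl

end Ty

/-! ### Operators with prescribed components -/

/-- All components of the operator, except for the one along the identity, are allowed in the
type `x`. -/
def Allowed (x : Ty) {S : Finset QSystem} (R : Op S) : Prop :=
  ∀ U K, Adapted K U → ¬ Disjoint U S → ¬ x.good U → pair K R = 0

/-- The positive operators with the trace and the components of a deterministic map of
type `x`. -/
structure IsDet (x : Ty) {S : Finset QSystem} (R : Op S) : Prop where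
  pos : R.PosSemidef
  trace : R.trace = x.inDim
  allowed : Allowed x R

theorem trace_one (S : Finset QSystem) : (1 : Op S).trace = ((∏ q ∈ S, q.dim : ℕ) : ℂ) := by
  rw [← prodOp_one, trace_prodOp]
  push_cast
  exact Finset.prod_congr rfl fun q _ => by simp

theorem Adapted.trace_prodOp {K : Fam} {U S : Finset QSystem} (hK : Adapted K U)
    (h : ¬ Disjoint U S) : (prodOp K S).trace = 0 := by
  obtain ⟨q, hU, hS⟩ := Finset.not_disjoint_iff.mp h
  rw [HigherOrder.trace_prodOp]
  exact Finset.prod_eq_zero hS (hK.1 q hU)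

theorem Adapted.pair_one {K : Fam} {U S : Finset QSystem} (hK : Adapted K U)
    (h : ¬ Disjoint U S) : pair K (1 : Op S) = 0 := by
  rw [pair_one_right, ← HigherOrder.trace_prodOp, hK.trace_prodOp h]

theorem allowed_one (x : Ty) (S : Finset QSystem) : Allowed x (1 : Op S) :=
  fun _ _ hK hU _ => hK.pair_one hU

theorem Allowed.add {x : Ty} {S : Finset QSystem} {R T : Op S} (hR : Allowed x R)
    (hT : Allowed x T) : Allowed x (R + T) := fun U K hK hU hg => by
  rw [pair_add, hR U K hK hU hg, hT U K hK hU hg, add_zero]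

theorem Allowed.smul {x : Ty} {S : Finset QSystem} {R : Op S} (hR : Allowed x R) (c : ℂ) :
    Allowed x (c • R) := fun U K hK hU hg => by
  rw [pair_smul, hR U K hK hU hg, mul_zero]

theorem Allowed.sum {x : Ty} {S : Finset QSystem} {ι : Type*} {s : Finset ι} {R : ι → Op S}
    (hR : ∀ i ∈ s, Allowed x (R i)) : Allowed x (∑ i ∈ s, R i) := fun U K hK hU hg => by
  rw [pair_sum]
  exact Finset.sum_eq_zero fun i hi => hR i hi U K hK hU hg

theorem Adapted.allowed {x : Ty} {S : Finset QSystem} (hS : x.systems ⊆ S) {L : Fam}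
    {V : Finset QSystem} (hL : Adapted L V) (hV : x.good V) : Allowed x (prodOp L S) := by
  intro U K hK hU hg
  refine pair_prodOp_eq_zero hK hL ?_
  by_contra! h
  refine hg ((Ty.good_congr ?_).mpr hV)
  ext q
  simp only [Finset.mem_inter, and_congr_left_iff]
  exact fun hq => h q (hS hq)

/-- Only the identity component is present, so this operator is a common base point for
perturbations in every type; dividing the total dimension by that of the outputs leaves that of the
inputs. -/
theorem isDet_smul_one {x : Ty} (hx : x.Linear) :
    IsDet x (((1 / x.outDim : ℝ) : ℂ) • (1 : Op x.systems)) where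
  pos := Matrix.PosSemidef.one.smul (by
    have : (0 : ℝ) ≤ 1 / x.outDim := by positivity
    exact_mod_cast this)
  trace := by
    rw [Matrix.trace_smul, trace_one, hx.prod_dim]
    have := x.outDim_ne_zero
    push_cast
    simp only [smul_eq_mul]
    field_simp
  allowed := (allowed_one _ _).smul _

theorem one_div_outDim_pos (x : Ty) : (0 : ℝ) < 1 / x.outDim := by
  have : 0 < x.outDim := Nat.pos_of_ne_zero (Ty.prod_dim_ne_zero _)
  positivity

theorem isDet_smul_one_add {x : Ty} (hx : x.Linear) {H : Op x.systems} (hH : H.trace = 0)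
    (ha : Allowed x H) (hp : (((1 / x.outDim : ℝ) : ℂ) • (1 : Op x.systems) + H).PosSemidef) :
    IsDet x (((1 / x.outDim : ℝ) : ℂ) • (1 : Op x.systems) + H) where
  pos := hp
  trace := by rw [Matrix.trace_add, (isDet_smul_one hx).trace, hH, add_zero]
  allowed := (isDet_smul_one hx).allowed.add ha

/-- A linear functional that is constant on the operators satisfying `IsDet` vanishes on the
allowed traceless product operators. -/
theorem map_prodOp_eq_zero {x : Ty} (hx : x.Linear) (f : Op x.systems →ₗ[ℂ] ℂ) {c : ℂ}
    (hf : ∀ R, IsDet x R → f R = c) {L : Fam} {V : Finset QSystem} (hL : Adapted L V)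
    (hV : x.good V) : f (prodOp L x.systems) = 0 := by
  have hd : ¬ Disjoint V x.systems := fun h => Ty.not_good_of_disjoint h hV
  -- Compare the values of `f` at the base point and at its perturbation by a small multiple of `H`.
  have key : ∀ H : Op x.systems, H.IsHermitian → H.trace = 0 → Allowed x H → f H = 0 := by
    intro H hH ht ha
    obtain ⟨r, hr, hpos⟩ := exists_smul_one_add_smul_posSemidef hH (one_div_outDim_pos x)
    have h1 := hf _ (isDet_smul_one_add hx (H := (r : ℂ) • H) (by simp [ht]) (ha.smul _)
      (hpos r hr.le le_rfl))
    rw [map_add, hf _ (isDet_smul_one hx), map_smul, smul_eq_mul, add_eq_left] at h1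
    exact (mul_eq_zero.mp h1).resolve_left (by exact_mod_cast hr.ne')
  let L' : Fam := fun q => (L q).conjTranspose
  have hL' : Adapted L' V := hL.conjTranspose
  have hc : (prodOp L x.systems).conjTranspose = prodOp L' x.systems := conjTranspose_prodOp L _
  have hc' : (prodOp L' x.systems).conjTranspose = prodOp L x.systems := by
    rw [← hc, Matrix.conjTranspose_conjTranspose]
  have a1 := hL.allowed (x := x) subset_rfl hV
  have a2 := hL'.allowed (x := x) subset_rfl hV
  have t1 := hL.trace_prodOp hd
  have t2 := hL'.trace_prodOp hd
  -- With `P` the product operator, `P + Pᴴ` and `i (P - Pᴴ)` are Hermitian and allowed; their two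
  -- vanishing values isolate `f P`.
  have h1 := key (prodOp L x.systems + prodOp L' x.systems)
    (by rw [Matrix.IsHermitian, Matrix.conjTranspose_add, hc, hc', add_comm])
    (by rw [Matrix.trace_add, t1, t2, add_zero]) (a1.add a2)
  have h2 := key (Complex.I • prodOp L x.systems + (-Complex.I) • prodOp L' x.systems)
    (by rw [Matrix.IsHermitian, Matrix.conjTranspose_add, Matrix.conjTranspose_smul,
          Matrix.conjTranspose_smul, hc, hc', add_comm]; simp)
    (by rw [Matrix.trace_add, Matrix.trace_smul, Matrix.trace_smul, t1, t2]; simp)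
    ((a1.smul _).add (a2.smul _))
  rw [map_add] at h1
  rw [map_add, map_smul, map_smul, smul_eq_mul, smul_eq_mul] at h2
  have h3 : Complex.I * f (prodOp L x.systems) * 2 = 0 := by linear_combination h2 + Complex.I * h1
  simpa using h3

/-! ### The action of Choi operators -/

section Choi

variable {X P Q Z : Finset QSystem}

theorem choiApply_add_right (M : Op P) (R T : Op Q) :
    choiApply X Z M (R + T) = choiApply X Z M R + choiApply X Z M T := by
  ext z w
  simp [choiApply, add_mul, Finset.sum_add_distrib]

theorem choiApply_smul_right (M : Op P) (c : ℂ) (R : Op Q) :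
    choiApply X Z M (c • R) = c • choiApply X Z M R := by
  ext z w
  simp [choiApply, Finset.mul_sum, mul_assoc]

theorem choiApply_sub_right (M : Op P) (R T : Op Q) :
    choiApply X Z M (R - T) = choiApply X Z M R - choiApply X Z M T := by
  ext z w
  simp [choiApply, sub_mul, Finset.sum_sub_distrib]

theorem choiApply_sub_left (M N : Op P) (R : Op Q) :
    choiApply X Z (M - N) R = choiApply X Z M R - choiApply X Z N R := by
  ext z w
  simp [choiApply, mul_sub, Finset.sum_sub_distrib]

/-- Pulled back to the labels of `X` and `Z`, the two operators are multiplied entrywise, which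
preserves positivity by Schur's product theorem; summing over `X` is a congruence. -/
theorem posSemidef_choiApply {M : Op P} {R : Op Q} (hM : M.PosSemidef) (hR : R.PosSemidef) :
    (choiApply X Z M R).PosSemidef := by
  have h1 := hM.submatrix fun p : Idx X × Idx Z => glue P p.1 p.2
  have h2 := hR.submatrix fun p : Idx X × Idx Z => glue Q p.1 p.2
  have h3 := posSemidef_sum_sum (h2.hadamard h1)
  convert h3 using 1
  ext z w
  rfl

theorem sum_rearrange {A B C D : Type*} [Fintype A] [Fintype B] [Fintype C] [Fintype D]
    (g : A → B → A → B → C → D → ℂ) :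
    ∑ y, ∑ e, ∑ y', ∑ e', ∑ a, ∑ b, g y e y' e' a b =
      ∑ a, ∑ b, ∑ e, ∑ e', ∑ y, ∑ y', g y e y' e' a b := by
  have h := Fintype.sum_equiv
    (ι := A × B × A × B × C × D) (κ := C × D × B × B × A × A)
    ⟨fun p => (p.2.2.2.2.1, p.2.2.2.2.2, p.2.1, p.2.2.2.1, p.1, p.2.2.1),
      fun p => (p.2.2.2.2.1, p.2.2.1, p.2.2.2.2.2, p.2.2.2.1, p.1, p.2.1),
      fun _ => rfl, fun _ => rfl⟩
    (fun p => g p.1 p.2.1 p.2.2.1 p.2.2.2.1 p.2.2.2.2.1 p.2.2.2.2.2)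
    (fun p => g p.2.2.2.2.1 p.2.2.1 p.2.2.2.2.2 p.2.2.2.1 p.1 p.2.1) (fun _ => rfl)
  simpa only [Fintype.sum_prod_type] using h

variable {Y E : Finset QSystem}

theorem pair_choiApply (hP : P = X ∪ Y) (hQ : Q = X ∪ E) (hZ : Z = Y ∪ E)
    (hYE : Disjoint Y E) (K : Fam) (M : Op P) (R : Op Q) :
    pair K (choiApply X Z M R) =
      ∑ a, ∑ b, partialPair K X E R a b * partialPair K X Y M a b := by
  have h1 : pair K (choiApply X Z M R) =
      ∑ y : Idx Y, ∑ e : Idx E, ∑ y' : Idx Y, ∑ e' : Idx E, ∑ a : Idx X, ∑ b : Idx X,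
        (prodOp K Y y y' * prodOp K E e e') *
          (R (glue Q a e) (glue Q b e') * M (glue P a y) (glue P b y')) := by
    rw [pair, sum_glue hZ hYE]
    refine Finset.sum_congr rfl fun y _ => Finset.sum_congr rfl fun e _ => ?_
    rw [sum_glue hZ hYE]
    refine Finset.sum_congr rfl fun y' _ => Finset.sum_congr rfl fun e' _ => ?_
    simp only [choiApply, prodOp_glue K hZ hYE, Finset.mul_sum,
      glue_glue hP.subset (Finset.subset_union_left.trans hZ.symm.subset),
      glue_glue_right hQ.subset (Finset.subset_union_right.trans hZ.symm.subset) hYE]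
  rw [h1, sum_rearrange]
  refine Finset.sum_congr rfl fun a _ => Finset.sum_congr rfl fun b _ => ?_
  simp only [partialPair]
  rw [Finset.sum_mul]
  refine Finset.sum_congr rfl fun e _ => ?_
  rw [Finset.sum_mul]
  refine Finset.sum_congr rfl fun e' _ => ?_
  rw [Finset.mul_sum]
  refine Finset.sum_congr rfl fun y _ => ?_
  rw [Finset.mul_sum]
  exact Finset.sum_congr rfl fun y' _ => by ring

/-- Each term couples a component of `R` with a component of `M` that has the same factors on the
shared systems `X`. This makes the recursive rule for `Ty.good` on arrows the right one. -/
theorem pair_choiApply_eq_sum (hP : P = X ∪ Y) (hQ : Q = X ∪ E) (hZ : Z = Y ∪ E)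
    (hXY : Disjoint X Y) (hXE : Disjoint X E) (hYE : Disjoint Y E) (K : Fam) (M : Op P) (R : Op Q) :
    pair K (choiApply X Z M R) = ∑ k : BasisIdx X, basisCoeff k *
      (pair (mix X (basisFam k) K) R * pair (mix X (basisFam k) K) M) := by
  rw [pair_choiApply hP hQ hZ hYE, sum_mul_eq_sum_basisFam]
  simp only [pair_partialPair _ _ hQ hXE, pair_partialPair _ _ hP hXY]

theorem pair_choiApply_prodOp (hP : P = X ∪ Y) (hQ : Q = X ∪ E) (hZ : Z = Y ∪ E)
    (hXY : Disjoint X Y) (hXE : Disjoint X E) (hYE : Disjoint Y E) (K L : Fam) (M : Op P) :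
    pair K (choiApply X Z M (prodOp L Q)) = pair K (prodOp L E) * pair (mix X L K) M := by
  rw [pair_choiApply hP hQ hZ hYE, partialPair_prodOp K L hQ hXE, ← pair_partialPair L K hP hXY,
    pair.eq_def L, Finset.mul_sum]
  refine Finset.sum_congr rfl fun a _ => ?_
  rw [Finset.mul_sum]
  exact Finset.sum_congr rfl fun b _ => by simp [mul_assoc]

end Choi

/-! ### Characterization of deterministic and admissible maps -/

/-- In the component expansion of a forbidden output component, every term has a zero factor: the
support on `X` is either forbidden for `R`, or else the total support is forbidden for `M`. For the
trace only the identity term survives. -/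
theorem IsDet.choiApply {x y : Ty} (h : (Ty.arrow x y).Linear) {E : Finset QSystem}
    (hE : Disjoint E (Ty.arrow x y).systems) {M : Op (Ty.arrow x y).systems}
    {R : Op (x.ext E).systems} (hM : IsDet (Ty.arrow x y) M) (hR : IsDet (x.ext E) R) :
    IsDet (y.ext E) (choiApply x.systems (y.ext E).systems M R) := by
  obtain ⟨hx, hy, hXY⟩ := id h
  have hE' := hE
  rw [Ty.systems, Finset.disjoint_union_right] at hE'
  have hexp := fun K => pair_choiApply_eq_sum (P := (Ty.arrow x y).systems) rfl (x.systems_ext E)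
    (y.systems_ext E) hXY hE'.1.symm hE'.2.symm K M R
  have hmix : ∀ {K : Fam} {V : Finset QSystem}, Adapted K V → Disjoint V x.systems →
      ∀ k : BasisIdx x.systems, Adapted (mix x.systems (basisFam k) K) (basisSupp k ∪ V) := by
    intro K V hK hV k
    have hb := adapted_basisFam k
    constructor
    · intro q hq
      by_cases hqx : q ∈ x.systems
      · have hqV : q ∉ V := Finset.disjoint_right.mp hV hqx
        simpa [mix, hqx] using hb.1 q ((Finset.mem_union.mp hq).resolve_right hqV)
      · have hqb : q ∉ basisSupp k := fun h => hqx (basisSupp_subset k h)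
        simpa [mix, hqx] using hK.1 q ((Finset.mem_union.mp hq).resolve_left hqb)
    · intro q hq
      rw [Finset.mem_union, not_or] at hq
      by_cases hqx : q ∈ x.systems
      · simpa [mix, hqx] using hb.2 q hq.1
      · simpa [mix, hqx] using hK.2 q hq.2
  -- If the total support misses `x` or is good for `x`, it is not good for `x → y` and the factor
  -- from `M` vanishes. Otherwise it is not good for `x ‖ E` and the factor from `R` vanishes.
  have hzero : ∀ {K : Fam} {V : Finset QSystem}, Adapted K V → Disjoint V x.systems →
      Disjoint V E → ¬ y.good V → ∀ k : BasisIdx x.systems, (basisSupp k ∪ V).Nonempty →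
      V ⊆ y.systems →
      pair (mix x.systems (basisFam k) K) R * pair (mix x.systems (basisFam k) K) M = 0 := by
    intro K V hK hVx hVE hVy k hne hV
    have hA := hmix hK hVx k
    have hsub := basisSupp_subset k
    have hby : Disjoint (basisSupp k) y.systems := hXY.mono_left hsub
    have hbE : Disjoint (basisSupp k) E := hE'.1.symm.mono_left hsub
    have hyg : ¬ y.good (basisSupp k ∪ V) := by
      rwa [Ty.good_congr (V := V)]
      rw [Finset.union_inter_distrib_right, Finset.disjoint_iff_inter_eq_empty.mp hby,
        Finset.empty_union]
    have hP : ¬ Disjoint (basisSupp k ∪ V) (Ty.arrow x y).systems := by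
      obtain ⟨q, hq⟩ := hne
      refine Finset.not_disjoint_iff.mpr ⟨q, hq, ?_⟩
      exact Finset.union_subset_union hsub hV hq
    by_cases hk : Disjoint (basisSupp k ∪ V) x.systems
    · rw [hM.allowed _ _ hA hP, mul_zero]
      simp [Ty.good, hyg, hk]
    by_cases hg : x.good (basisSupp k ∪ V)
    · rw [hM.allowed _ _ hA hP, mul_zero]
      simp [Ty.good, hyg, hg]
    · rw [hR.allowed _ _ hA, zero_mul]
      · intro h
        refine hk (h.mono_right ?_)
        rw [Ty.systems_ext]
        exact Finset.subset_union_left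
      · rw [Ty.good_ext, Finset.disjoint_union_left]
        simp [hbE, hVE, hg]
  refine ⟨posSemidef_choiApply hM.pos hR.pos, ?_, ?_⟩
  · let k₀ : BasisIdx x.systems := fun _ => none
    have hs : ∀ k : BasisIdx x.systems, k ≠ k₀ → (basisSupp k ∪ ∅).Nonempty := by
      intro k hk
      rw [Finset.union_empty]
      exact basisSupp_nonempty hk
    have hm : mix x.systems (basisFam k₀) 1 = 1 := by
      rw [basisFam_none]
      funext q
      simp [mix]
    rw [← pair_one_left, hexp, Finset.sum_eq_single k₀, hm, pair_one_left, pair_one_left, hR.trace,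
      hM.trace, h.inDim_arrow, Ty.inDim, Ty.inSys_ext, Ty.inDim, Ty.inDim, Ty.inSys_ext]
    · rw [basisCoeff_none, hx.prod_dim, Ty.inDim]
      have h1 := x.outDim_ne_zero
      have h2 : ((∏ q ∈ x.inSys, q.dim : ℕ) : ℂ) ≠ 0 := Nat.cast_ne_zero.mpr (Ty.prod_dim_ne_zero _)
      rw [Nat.cast_mul, Nat.cast_mul]
      field_simp
    · intro k _ hk
      rw [hzero adapted_one (by simp) (by simp) (Ty.not_good_of_disjoint (by simp)) k (hs k hk)
        (by simp), mul_zero]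
    · simp
  · intro V K hK hVne hVg
    rw [Ty.good_ext, not_or, not_not] at hVg
    -- The support may contain systems foreign to the operator. Being disjoint from `E`, it can be
    -- cut down to `y` without changing the pairing.
    let V' := V ∩ y.systems
    let K' : Fam := mix y.systems K 1
    have hK' : Adapted K' V' := by
      constructor
      · intro q hq
        obtain ⟨h1, h2⟩ := Finset.mem_inter.mp hq
        simpa [K', mix, h2] using hK.1 q h1
      · intro q hq
        by_cases h2 : q ∈ y.systems
        · have : q ∉ V := fun h1 => hq (Finset.mem_inter.mpr ⟨h1, h2⟩)
          simpa [K', mix, h2] using hK.2 q this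
        · simp [K', mix, h2]
    rw [pair_congr (L := K'), hexp]
    · refine Finset.sum_eq_zero fun k _ => ?_
      rw [hzero hK' (hXY.symm.mono_left Finset.inter_subset_right)
        (hVg.1.mono_left Finset.inter_subset_left) _ k _ Finset.inter_subset_right, mul_zero]
      · rw [Ty.good_congr (V := V)]
        · exact hVg.2
        · simp [V', Finset.inter_assoc]
      · obtain ⟨q, h1, h2⟩ := Finset.not_disjoint_iff.mp hVne
        rw [Ty.systems_ext, Finset.mem_union] at h2
        exact ⟨q, Finset.mem_union_right _ (Finset.mem_inter.mpr
          ⟨h1, h2.resolve_right (Finset.disjoint_left.mp hVg.1 h1)⟩)⟩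
    · intro q hq
      by_cases h2 : q ∈ y.systems
      · simp [K', mix, h2]
      · rw [Ty.systems_ext, Finset.mem_union] at hq
        simp [K', mix, h2, hK.2 q (Finset.disjoint_right.mp hVg.1 (hq.resolve_left h2))]

/-- The empty extension already suffices once `M` is positive. Components of `M` trivial on `x` are
read off from the image of the normalized identity; those good on `x` are handled by linear
functionals that are constant on deterministic inputs. -/
theorem isDet_of_choiApply {x y : Ty} (h : (Ty.arrow x y).Linear)
    {M : Op (Ty.arrow x y).systems} (hpos : M.PosSemidef)
    (hM : ∀ R : Op (x.ext ∅).systems, IsDet (x.ext ∅) R →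
      IsDet (y.ext ∅) (choiApply x.systems (y.ext ∅).systems M R)) : IsDet (Ty.arrow x y) M := by
  obtain ⟨hx, hy, hXY⟩ := id h
  have hx' : (x.ext ∅).Linear := hx.ext (by simp)
  have hexp := fun K L => pair_choiApply_prodOp (P := (Ty.arrow x y).systems) rfl (x.systems_ext ∅)
    (y.systems_ext ∅) hXY (by simp) (by simp) K L M
  have hpe : ∀ K L : Fam, pair K (prodOp L ∅) = 1 := fun K L => by rw [pair_prodOp]; simp
  have hmix : ∀ K : Fam, mix x.systems K K = K := fun K => by funext q; simp [mix]
  have hsx : (x.ext ∅).systems = x.systems := by rw [Ty.systems_ext, Finset.union_empty]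
  have hsy : (y.ext ∅).systems = y.systems := by rw [Ty.systems_ext, Finset.union_empty]
  have hone : ∀ K : Fam, prodOp K (x.ext ∅).systems = 1 →
      pair K (choiApply x.systems (y.ext ∅).systems M
        (((1 / (x.ext ∅).outDim : ℝ) : ℂ) • (1 : Op (x.ext ∅).systems))) =
      ((1 / (x.ext ∅).outDim : ℝ) : ℂ) * pair K M := by
    intro K hK
    rw [choiApply_smul_right, pair_smul, ← hK, hexp, hpe, hmix, one_mul]
  refine ⟨hpos, ?_, ?_⟩
  · have h1 := (hM _ (isDet_smul_one hx')).trace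
    rw [← pair_one_left, hone _ (prodOp_one _), pair_one_left] at h1
    have h2 : (x.ext ∅).outDim = x.outDim := by
      have h3 := hx'.prod_dim
      have h4 : (x.ext ∅).inDim = x.inDim := by rw [Ty.inDim, Ty.inSys_ext, Ty.inDim]
      rw [hsx, hx.prod_dim, h4] at h3
      exact (Nat.eq_of_mul_eq_mul_left (Nat.pos_of_ne_zero (Ty.prod_dim_ne_zero _)) h3).symm
    rw [h2, Ty.inDim, Ty.inSys_ext] at h1
    rw [h.inDim_arrow, Nat.cast_mul, Ty.inDim, ← h1]
    have := x.outDim_ne_zero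
    push_cast
    field_simp
  · intro U K hK hU hg
    simp only [Ty.good, not_or, not_and, not_not] at hg
    have hgy : ¬ (y.ext ∅).good U := by simp [Ty.good_ext, hg.1]
    by_cases hUx : Disjoint U x.systems
    · have hUy : ¬ Disjoint U (y.ext ∅).systems := by
        rw [hsy]
        intro h
        exact hU (Finset.disjoint_union_right.mpr ⟨hUx, h⟩)
      have h1 := (hM _ (isDet_smul_one hx')).allowed U K hK hUy hgy
      rw [hone K (hK.eq_one_of_disjoint (by rwa [hsx]))] at h1
      refine (mul_eq_zero.mp h1).resolve_left ?_
      exact_mod_cast (one_div_outDim_pos (x.ext ∅)).ne'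
    · have hgx : (x.ext ∅).good U := by simp [Ty.good_ext, hg.2 hUx]
      let f : Op (x.ext ∅).systems →ₗ[ℂ] ℂ :=
        { toFun := fun R => pair K (choiApply x.systems (y.ext ∅).systems M R)
          map_add' := fun R T => by rw [choiApply_add_right, pair_add]
          map_smul' := fun c R => by
            rw [choiApply_smul_right, pair_smul, RingHom.id_apply, smul_eq_mul] }
      -- When `U` misses `y`, the functional is the trace of the output, hence constant; otherwise
      -- it tests a forbidden component of the output and is zero.
      have hf : ∃ c, ∀ R, IsDet (x.ext ∅) R → f R = c := by
        by_cases hUy : Disjoint U (y.ext ∅).systems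
        · refine ⟨(y.ext ∅).inDim, fun R hR => ?_⟩
          rw [← (hM R hR).trace, ← pair_one_left]
          exact pair_congr (fun q hq => hK.2 q (Finset.disjoint_right.mp hUy hq)) _
        · exact ⟨0, fun R hR => (hM R hR).allowed U K hK hUy hgy⟩
      obtain ⟨c, hc⟩ := hf
      have h1 := map_prodOp_eq_zero hx' f hc hK hgx
      have h2 : f (prodOp K (x.ext ∅).systems) = pair K M := by
        change pair K (choiApply x.systems (y.ext ∅).systems M (prodOp K _)) = _
        rw [hexp, hpe, hmix, one_mul]
      rw [← h2, h1]

-- Positivity of Choi operators from an entangled input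

/-- The system with the same dimension whose label is shifted. -/
def QSystem.shift (n : ℕ) (q : QSystem) : QSystem := ⟨q.dim, q.label + n, q.two_le⟩

/-- The inverse of `QSystem.shift`. -/
def QSystem.unshift (n : ℕ) (q : QSystem) : QSystem := ⟨q.dim, q.label - n, q.two_le⟩

theorem QSystem.unshift_shift (n : ℕ) (q : QSystem) : (q.shift n).unshift n = q := by
  simp [shift, unshift]

theorem exists_disjoint_shift (S : Finset QSystem) :
    ∃ n, ∀ q : QSystem, q.shift n ∉ S := by
  refine ⟨S.sup QSystem.label + 1, fun q hq => ?_⟩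
  have := Finset.le_sup (f := QSystem.label) hq
  simp only [QSystem.shift] at this
  omega

/-- As in Choi's theorem, the map is applied to half of a maximally entangled operator on `x` and a
fresh copy of `x`. A small multiple of that operator is dominated by the normalized identity, so it
is a legitimate input, and the output is a multiple of `M` up to relabelling. -/
theorem posSemidef_of_choiApply {x y : Ty} (h : (Ty.arrow x y).Linear)
    {M : Op (Ty.arrow x y).systems}
    (hM : ∀ E : Finset QSystem, Disjoint E (Ty.arrow x y).systems →
      ∀ R N : Op (x.ext E).systems, R.PosSemidef → IsDet (x.ext E) N → (N - R).PosSemidef →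
        (choiApply x.systems (y.ext E).systems M R).PosSemidef) : M.PosSemidef := by
  obtain ⟨n, hn⟩ := exists_disjoint_shift (Ty.arrow x y).systems
  let E : Finset QSystem := x.systems.image (QSystem.shift n)
  have hE : Disjoint E (Ty.arrow x y).systems := by
    rw [Finset.disjoint_left]
    intro q hq
    obtain ⟨p, -, rfl⟩ := Finset.mem_image.mp hq
    exact hn p
  have hE' := hE
  rw [Ty.systems, Finset.disjoint_union_right] at hE'
  have hx' : (x.ext E).Linear := h.1.ext hE'.1
  have hXQ : ∀ q ∈ x.systems, q ∈ (x.ext E).systems := fun q hq => by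
    rw [Ty.systems_ext]
    exact Finset.mem_union_left _ hq
  have hEQ : ∀ q ∈ x.systems, q.shift n ∈ (x.ext E).systems := fun q hq => by
    rw [Ty.systems_ext]
    exact Finset.mem_union_right _ (Finset.mem_image_of_mem _ hq)
  have hEZ : ∀ q ∈ x.systems, q.shift n ∈ (y.ext E).systems := fun q hq => by
    rw [Ty.systems_ext]
    exact Finset.mem_union_right _ (Finset.mem_image_of_mem _ hq)
  -- The unnormalized maximally entangled vector: each system of `x` agrees with its shifted copy.
  let v : Idx (x.ext E).systems → ℂ := fun q =>
    if ∀ i : x.systems, (q ⟨i.1, hXQ i.1 i.2⟩).val = (q ⟨i.1.shift n, hEQ i.1 i.2⟩).val then 1 else 0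
  have hvs : star v = v := by
    funext q
    simp only [v, Pi.star_apply]
    split_ifs <;> simp
  have hV : (Matrix.vecMulVec v v).PosSemidef := by
    simpa only [hvs] using Matrix.posSemidef_vecMulVec_self_star v
  obtain ⟨r, hr, hpos⟩ := exists_smul_one_add_smul_posSemidef hV.1.neg (one_div_outDim_pos (x.ext E))
  have hr0 : (0 : ℂ) ≤ (r : ℂ) := by exact_mod_cast hr.le
  have key := hM E hE ((r : ℂ) • Matrix.vecMulVec v v) _ (hV.smul hr0) (isDet_smul_one hx') (by
    have h1 := hpos r hr.le le_rfl
    rwa [smul_neg, ← sub_eq_add_neg] at h1)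
  -- Relabels the shifted copy back to `x`. The last branch is never reached, since a system outside
  -- `y` lies in `E`.
  let g : Idx (Ty.arrow x y).systems → Idx (y.ext E).systems := fun p j =>
    if hj : j.1 ∈ y.systems then p ⟨j.1, Finset.mem_union_right _ hj⟩
    else if hj : j.1.unshift n ∈ x.systems then p ⟨j.1.unshift n, Finset.mem_union_left _ hj⟩
    else ⟨0, Nat.pos_of_ne_zero j.1.dim_ne_zero⟩
  let res : Idx (Ty.arrow x y).systems → Idx x.systems := fun p i =>
    p ⟨i.1, Finset.mem_union_left _ i.2⟩
  have hg1 : ∀ p (i : x.systems), (g p ⟨i.1.shift n, hEZ i.1 i.2⟩).val = (res p i).val := by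
    intro p i
    have h1 : i.1.shift n ∉ y.systems := fun h' => hn i.1 (Finset.mem_union_right _ h')
    have h2 : (i.1.shift n).unshift n ∈ x.systems := by rw [QSystem.unshift_shift]; exact i.2
    have h3 : ∀ (q : QSystem) (hq : q ∈ x.systems), q = i.1 →
        (p ⟨q, Finset.mem_union_left _ hq⟩).val = (res p i).val := by
      rintro q hq rfl
      rfl
    simp only [g, h1, dif_neg, not_false_eq_true]
    exact (congrArg Fin.val (dif_pos h2)).trans (h3 _ h2 (QSystem.unshift_shift n i.1))
  have hv : ∀ (a : Idx x.systems) (p : Idx (Ty.arrow x y).systems),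
      v (glue (x.ext E).systems a (g p)) = if a = res p then 1 else 0 := by
    intro a p
    have h1 : ∀ i : x.systems, i.1.shift n ∉ x.systems :=
      fun i h' => hn i.1 (Finset.mem_union_left _ h')
    simp only [v]
    congr 1
    rw [eq_iff_iff, funext_iff]
    refine forall_congr' fun i => ?_
    have e1 : glue (x.ext E).systems a (g p) ⟨i.1, hXQ i.1 i.2⟩ = a i := glue_of_mem _ _ _ i.2
    have e2 : glue (x.ext E).systems a (g p) ⟨i.1.shift n, hEQ i.1 i.2⟩ =
        g p ⟨i.1.shift n, hEZ i.1 i.2⟩ := glue_of_notMem _ _ _ (h1 i) _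
    rw [e1, e2, hg1, Fin.ext_iff]
  have hglue : ∀ p, glue (Ty.arrow x y).systems (res p) (g p) = p := by
    intro p
    funext i
    by_cases hi : i.1 ∈ x.systems
    · rw [glue_of_mem _ _ _ hi]
    · have hy : i.1 ∈ y.systems := (Finset.mem_union.mp i.2).resolve_left hi
      rw [glue_of_notMem _ _ _ hi (by rw [Ty.systems_ext]; exact Finset.mem_union_left _ hy)]
      simp [g, hy]
  have h2 := key.submatrix g
  have h3 : (choiApply x.systems (y.ext E).systems M ((r : ℂ) • Matrix.vecMulVec v v)).submatrix g g
      = (r : ℂ) • M := by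
    ext p p'
    rw [Matrix.submatrix_apply, choiApply_smul_right, Matrix.smul_apply, Matrix.smul_apply]
    congr 1
    simp only [HigherOrder.choiApply, Matrix.vecMulVec_apply, hv, ite_mul, one_mul, zero_mul,
      Finset.sum_ite_irrel, Finset.sum_const_zero, Finset.sum_ite_eq', Finset.mem_univ, if_true,
      hglue]
  rw [h3] at h2
  have hr' : (0 : ℂ) ≤ ((r⁻¹ : ℝ) : ℂ) := by exact_mod_cast (inv_pos.mpr hr).le
  have h4 := h2.smul hr'
  rwa [smul_smul, ← Complex.ofReal_mul, inv_mul_cancel₀ hr.ne', Complex.ofReal_one, one_smul] at h4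

-- Collapse of the recursive definition

/-- An operator is dominated by a deterministic one. -/
def IsSubDet (x : Ty) {S : Finset QSystem} (M : Op S) : Prop :=
  M.PosSemidef ∧ ∃ N : Op S, IsDet x N ∧ (N - M).PosSemidef

theorem IsDet.isSubDet {x : Ty} {S : Finset QSystem} {M : Op S} (h : IsDet x M) : IsSubDet x M :=
  ⟨h.pos, M, h, by rw [sub_self]; exact Matrix.PosSemidef.zero⟩

theorem IsSubDet.choiApply {x y : Ty} (h : (Ty.arrow x y).Linear) {E : Finset QSystem}
    (hE : Disjoint E (Ty.arrow x y).systems) {M : Op (Ty.arrow x y).systems}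
    {R : Op (x.ext E).systems} (hM : IsSubDet (Ty.arrow x y) M) (hR : IsSubDet (x.ext E) R) :
    IsSubDet (y.ext E) (HigherOrder.choiApply x.systems (y.ext E).systems M R) := by
  obtain ⟨hM, N, hN, hNM⟩ := hM
  obtain ⟨hR, T, hT, hTR⟩ := hR
  refine ⟨posSemidef_choiApply hM hR, _, hN.choiApply h hE hT, ?_⟩
  have h1 := (posSemidef_choiApply (X := x.systems) (Z := (y.ext E).systems) hNM hT.pos).add
    (posSemidef_choiApply (X := x.systems) (Z := (y.ext E).systems) hM hTR)
  rwa [choiApply_sub_left, choiApply_sub_right, sub_add_sub_cancel] at h1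

/-- The induction is on size because the extended types are not subterms. Condition (i) forces
positivity, preservation of deterministic maps forces the trace and component conditions, and
`IsDet.choiApply` and `IsSubDet.choiApply` give the converses. -/
theorem maps_eq {x : Ty} (hx : x.Linear) : x.maps = ({M | IsSubDet x M}, {M | IsDet x M}) := by
  induction hn : x.size using Nat.strong_induction_on generalizing x with
  | _ n ih =>
    cases x with
    | elem s =>
      have h : ∀ M : Op s, IsDet (Ty.elem s) M ↔ M.PosSemidef ∧ M.trace = 1 := by
        intro M
        constructor
        · intro h
          exact ⟨h.pos, by simpa [Ty.inDim, Ty.inSys] using h.trace⟩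
        · rintro ⟨h1, h2⟩
          exact ⟨h1, by simpa [Ty.inDim, Ty.inSys] using h2, fun U K _ hU hg => absurd hU hg⟩
      rw [Ty.maps]
      simp only [IsSubDet]
      refine Prod.ext ?_ ?_
      · ext M
        exact and_congr_right fun _ => exists_congr fun N => and_congr_left fun _ => (h N).symm
      · ext M
        exact (h M).symm
    | arrow x y =>
      have hpx := x.size_pos
      have hpy := y.size_pos
      have hsz : x.size + y.size = n := hn
      have hx' : ∀ E : Finset QSystem, Disjoint E (Ty.arrow x y).systems →
          (x.ext E).maps = ({M | IsSubDet (x.ext E) M}, {M | IsDet (x.ext E) M}) := fun E hE =>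
        ih _ (by rw [Ty.size_ext]; omega)
          (hx.1.ext (hE.mono_right Finset.subset_union_left)) rfl
      have hy' : ∀ E : Finset QSystem, Disjoint E (Ty.arrow x y).systems →
          (y.ext E).maps = ({M | IsSubDet (y.ext E) M}, {M | IsDet (y.ext E) M}) := fun E hE =>
        ih _ (by rw [Ty.size_ext]; omega)
          (hx.2.1.ext (hE.mono_right Finset.subset_union_right)) rfl
      let presAdm : Op (Ty.arrow x y).systems → Prop := fun M =>
        ∀ E : Finset QSystem, Disjoint E (Ty.arrow x y).systems →
          ∀ R ∈ (Ty.maps (x.ext E)).1,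
            choiApply x.systems (y.ext E).systems M R ∈ (Ty.maps (y.ext E)).1
      let presDet : Op (Ty.arrow x y).systems → Prop := fun M =>
        ∀ E : Finset QSystem, Disjoint E (Ty.arrow x y).systems →
          ∀ R ∈ (Ty.maps (x.ext E)).2,
            choiApply x.systems (y.ext E).systems M R ∈ (Ty.maps (y.ext E)).2
      have hpos : ∀ M, presAdm M → M.PosSemidef := by
        intro M hM
        refine posSemidef_of_choiApply hx fun E hE R N hR hN hNR => ?_
        have h1 := hM E hE R (by rw [hx' E hE]; exact ⟨hR, N, hN, hNR⟩)
        rw [hy' E hE] at h1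
        exact h1.1
      have hdet : ∀ M, M.PosSemidef → presDet M → IsDet (Ty.arrow x y) M := by
        intro M hM hd
        refine isDet_of_choiApply hx hM fun R hR => ?_
        have h1 := hd ∅ (by simp) R (by rw [hx' ∅ (by simp)]; exact hR)
        rwa [hy' ∅ (by simp)] at h1
      have hadm' : ∀ M, IsSubDet (Ty.arrow x y) M → presAdm M := by
        intro M hM E hE R hR
        rw [hx' E hE] at hR
        rw [hy' E hE]
        exact hM.choiApply hx hE hR
      have hdet' : ∀ M, IsDet (Ty.arrow x y) M → presDet M := by
        intro M hM E hE R hR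
        rw [hx' E hE] at hR
        rw [hy' E hE]
        exact hM.choiApply hx hE hR
      have hsub : ∀ M, (presAdm M ∧ ∃ (n : ℕ) (N : Fin n → Op (Ty.arrow x y).systems),
          (∀ i, presAdm (N i)) ∧ presDet (M + ∑ i, N i)) ↔ IsSubDet (Ty.arrow x y) M := by
        intro M
        constructor
        · rintro ⟨hM, n, N, hN, hd⟩
          have hs : (∑ i, N i).PosSemidef :=
            Matrix.posSemidef_sum _ fun i _ => hpos _ (hN i)
          refine ⟨hpos M hM, M + ∑ i, N i, hdet _ ((hpos M hM).add hs) hd, ?_⟩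
          rwa [add_sub_cancel_left]
        · intro hM
          obtain ⟨h1, N, hN, h2⟩ := id hM
          -- A single complement `N - M` completes `M` to a deterministic map; it is itself
          -- dominated by `N`.
          refine ⟨hadm' M hM, 1, fun _ => N - M, fun _ => hadm' _ ⟨h2, N, hN, ?_⟩, ?_⟩
          · rwa [sub_sub_cancel]
          · rw [Fin.sum_univ_one, add_sub_cancel]
            exact hdet' N hN
      have hmaps : (Ty.arrow x y).maps =
          ({M | presAdm M ∧ ∃ (n : ℕ) (N : Fin n → Op (Ty.arrow x y).systems),
            (∀ i, presAdm (N i)) ∧ presDet (M + ∑ i, N i)},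
           {M | (presAdm M ∧ ∃ (n : ℕ) (N : Fin n → Op (Ty.arrow x y).systems),
            (∀ i, presAdm (N i)) ∧ presDet (M + ∑ i, N i)) ∧ presDet M}) := by
        rw [Ty.maps]
      rw [hmaps]
      simp only [hsub]
      refine Prod.ext rfl ?_
      ext M
      exact ⟨fun h => hdet M h.1.1 h.2, fun h => ⟨h.isSubDet, hdet' M h⟩⟩

theorem mem_deterministicMaps {x : Ty} (hx : x.Linear) {R : Op x.systems} :
    R ∈ x.deterministicMaps ↔ IsDet x R := by
  rw [Ty.deterministicMaps, maps_eq hx]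
  rfl

theorem isDeterministicOfType_iff {z : Ty} (hz : z.Linear) {S : Finset QSystem} {R : Op S} :
    IsDeterministicOfType R z ↔ S = z.systems ∧ IsDet z R := by
  constructor
  · rintro ⟨rfl, h⟩
    exact ⟨rfl, (mem_deterministicMaps hz).mp h⟩
  · rintro ⟨rfl, h⟩
    exact ⟨rfl, (mem_deterministicMaps hz).mpr h⟩

/-! ### Strings and supports -/

namespace Ty

theorem nonempty_of_mem_ele {x : Ty} {A : Finset QSystem} (h : A ∈ x.ele) : A.Nonempty := by
  induction x with
  | elem s =>
    by_cases hs : s = ∅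
    · simp [ele, hs] at h
    · simp only [ele, hs, if_false, Finset.mem_singleton] at h
      rw [h]
      exact Finset.nonempty_iff_ne_empty.mpr hs
  | arrow x y hx hy => exact (Finset.mem_union.mp h).elim hx hy

theorem mem_systems_iff {x : Ty} {q : QSystem} : q ∈ x.systems ↔ ∃ A ∈ x.ele, q ∈ A := by
  induction x with
  | elem s =>
    by_cases hs : s = ∅ <;> simp [ele, hs, systems]
  | arrow x y hx hy => simp only [systems, ele, Finset.mem_union, hx, hy, or_and_right, exists_or]

theorem subset_systems_of_mem_ele {x : Ty} {A : Finset QSystem} (h : A ∈ x.ele) :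
    A ⊆ x.systems := fun _ hq => mem_systems_iff.mpr ⟨A, h, hq⟩

theorem disjoint_systems_iff {x : Ty} {U : Finset QSystem} :
    Disjoint U x.systems ↔ ∀ A ∈ x.ele, Disjoint U A := by
  simp only [Finset.disjoint_left, mem_systems_iff]
  grind

theorem Linear.disjoint_ele {x : Ty} (hx : x.Linear) {A B : Finset QSystem} (hA : A ∈ x.ele)
    (hB : B ∈ x.ele) (hAB : A ≠ B) : Disjoint A B := by
  induction x with
  | elem s =>
    by_cases hs : s = ∅
    · simp [ele, hs] at hA
    · simp only [ele, hs, if_false, Finset.mem_singleton] at hA hB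
      exact absurd (hA.trans hB.symm) hAB
  | arrow x y ihx ihy =>
    obtain ⟨h1, h2, h3⟩ := hx
    rcases Finset.mem_union.mp hA with hA | hA <;> rcases Finset.mem_union.mp hB with hB | hB
    · exact ihx h1 hA hB
    · exact h3.mono (subset_systems_of_mem_ele hA) (subset_systems_of_mem_ele hB)
    · exact h3.symm.mono (subset_systems_of_mem_ele hA) (subset_systems_of_mem_ele hB)
    · exact ihy h2 hA hB

theorem marks_mod_two (x : Ty) : x.marks % 2 = 0 := by
  induction x with
  | elem s => rfl
  | arrow x y hx hy => simp only [marks]; omega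

theorem subset_inSys_and_outSys {x : Ty} {A : Finset QSystem} (hA : A ∈ x.ele) :
    (x.marksRight A % 2 = 1 → A ⊆ x.inSys) ∧ (x.marksRight A % 2 = 0 → A ⊆ x.outSys) := by
  induction x with
  | elem s =>
    by_cases hs : s = ∅
    · simp [ele, hs] at hA
    · simp only [ele, hs, if_false, Finset.mem_singleton] at hA
      simp [marksRight, outSys, hA]
  | arrow x y hx hy =>
    have hm := marks_mod_two y
    by_cases h : A ∈ x.ele
    · simp only [marksRight, h, if_true, inSys, outSys]
      exact ⟨fun h' => ((hx h).2 (by omega)).trans Finset.subset_union_left,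
        fun h' => ((hx h).1 (by omega)).trans Finset.subset_union_left⟩
    · have h' : A ∈ y.ele := (Finset.mem_union.mp hA).resolve_left h
      simp only [marksRight, h, if_false, inSys, outSys]
      exact ⟨fun h1 => ((hy h').1 h1).trans Finset.subset_union_right,
        fun h1 => ((hy h').2 h1).trans Finset.subset_union_right⟩

theorem subset_inSys {x : Ty} {A : Finset QSystem} (hA : A ∈ x.inputs) : A ⊆ x.inSys :=
  (subset_inSys_and_outSys (Finset.mem_filter.mp hA).1).1 (Finset.mem_filter.mp hA).2

theorem subset_outSys {x : Ty} {A : Finset QSystem} (hA : A ∈ x.outputs) : A ⊆ x.outSys := by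
  obtain ⟨h1, h2⟩ := Finset.mem_sdiff.mp hA
  refine (subset_inSys_and_outSys h1).2 ?_
  have h3 : ¬ x.marksRight A % 2 = 1 := fun h => h2 (Finset.mem_filter.mpr ⟨h1, h⟩)
  omega

theorem mem_inputs_or_mem_outputs {x : Ty} {A : Finset QSystem} (hA : A ∈ x.ele) :
    A ∈ x.inputs ∨ A ∈ x.outputs := by
  by_cases h : A ∈ x.inputs
  · exact Or.inl h
  · exact Or.inr (Finset.mem_sdiff.mpr ⟨hA, h⟩)

end Ty

/-- The string with a zero at the elementary types that meet `U`. -/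
def strOf (A : Finset (Finset QSystem)) (U : Finset QSystem) : Str A :=
  fun i => if Disjoint U i.1 then 1 else 0

theorem strOf_eq_zero {A : Finset (Finset QSystem)} {U : Finset QSystem} (i : A) :
    strOf A U i = 0 ↔ ¬ Disjoint U i.1 := by
  simp [strOf]

theorem strOf_eq_one {A : Finset (Finset QSystem)} {U : Finset QSystem} (i : A) :
    strOf A U i = 1 ↔ Disjoint U i.1 := by
  simp [strOf]

theorem strOf_mem_strings {x : Ty} {U : Finset QSystem} :
    strOf x.ele U ∈ x.strings ↔ x.good U := by
  induction x with
  | elem s =>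
    by_cases hs : s = ∅
    · subst hs
      simp [Ty.strings, Ty.good]
    · have h : (Ty.elem s).strings = {fun _ => 0} := by simp [Ty.strings, hs]
      have hm : s ∈ (Ty.elem s).ele := by simp [Ty.ele, hs]
      rw [h, Finset.mem_singleton, Ty.good]
      constructor
      · intro h1
        exact (strOf_eq_zero ⟨s, hm⟩).mp (congrFun h1 ⟨s, hm⟩)
      · intro h1
        funext i
        have hi : i.1 = s := by
          have := i.2
          simpa only [Ty.ele, hs, if_false, Finset.mem_singleton] using this
        rw [strOf_eq_zero, hi]
        exact h1
  | arrow x y hx hy =>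
    have h1 : ∀ {A B : Finset (Finset QSystem)} (h : A ⊆ B),
        Str.restrict h (strOf B U) = strOf A U := fun _ => rfl
    have h2 : strOf x.ele U = Str.ones x.ele ↔ Disjoint U x.systems := by
      rw [Ty.disjoint_systems_iff, funext_iff, Subtype.forall]
      exact forall₂_congr fun A hA => strOf_eq_one ⟨A, hA⟩
    change strOf (x.ele ∪ y.ele) U ∈ concat Finset.univ y.strings ∪
      concat (Str.nonOnes x.ele \ x.strings) (Finset.univ \ y.strings) ↔ _
    rw [Finset.mem_union, concat, concat, Finset.mem_filter, Finset.mem_filter]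
    simp only [Finset.mem_univ, true_and, Finset.mem_sdiff, h1]
    rw [hx, hy, Str.nonOnes, Finset.mem_sdiff, Finset.mem_singleton, h2, Ty.good]
    have h3 : strOf x.ele U ∈ Finset.univ := Finset.mem_univ _
    tauto

/-- Take the union of the elementary types marked by zero. These are nonempty, and linearity makes
distinct ones disjoint, so no other bit is switched. -/
theorem Ty.Linear.exists_strOf {x : Ty} (hx : x.Linear) (w : Str x.ele) :
    ∃ U, w = strOf x.ele U := by
  refine ⟨(Finset.univ.filter fun i => w i = 0).biUnion fun i => i.1, ?_⟩
  have h01 : ∀ a : Fin 2, a = 0 ∨ a = 1 := by decide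
  funext i
  rcases h01 (w i) with h | h
  · rw [h, eq_comm, strOf_eq_zero]
    obtain ⟨q, hq⟩ := Ty.nonempty_of_mem_ele i.2
    exact Finset.not_disjoint_iff.mpr ⟨q, Finset.mem_biUnion.mpr
      ⟨i, Finset.mem_filter.mpr ⟨Finset.mem_univ _, h⟩, hq⟩, hq⟩
  · rw [h, eq_comm, strOf_eq_one, Finset.disjoint_biUnion_left]
    intro j hj
    refine hx.disjoint_ele j.2 i.2 fun hij => ?_
    have h0 := (Finset.mem_filter.mp hj).2
    rw [Subtype.ext hij, h] at h0
    exact one_ne_zero h0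

/-- A support may be changed inside composite elementary types as long as it meets the same ones.
This freedom is needed because the identification of a pair need not respect tensor factors. -/
theorem Ty.good_iff_of_ele {x : Ty} {U V : Finset QSystem}
    (h : ∀ A ∈ x.ele, Disjoint U A ↔ Disjoint V A) : x.good U ↔ x.good V := by
  rw [← strOf_mem_strings, ← strOf_mem_strings]
  have : strOf x.ele U = strOf x.ele V := by
    funext i
    simp only [strOf, h i.1 i.2]
  rw [this]

/-- The supports of the components that obstruct the contraction of `H`. -/
def Obstructs (x : Ty) (H : List EquivPair) (U : Finset QSystem) : Prop :=
  (∃ p ∈ H, ¬ Disjoint U p.fst) ∧ (∀ p ∈ H, Disjoint U p.fst ↔ Disjoint U p.snd) ∧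
    ∀ B ∈ x.outputs, (∀ p ∈ H, p.snd ≠ B) → Disjoint U B

theorem strOf_mem_badStrings {x : Ty} {H : List EquivPair}
    (hH : ∀ p ∈ H, p.fst ∈ x.inputs ∧ p.snd ∈ x.outputs) {U : Finset QSystem} :
    strOf x.ele U ∈ badStrings x H ↔ Obstructs x H U := by
  have hin : ∀ {A}, A ∈ inH x H ↔ ∃ p ∈ H, p.fst = A := by
    intro A
    simp only [inH, Finset.mem_filter]
    constructor
    · rintro ⟨-, p, hp, h, -⟩
      exact ⟨p, hp, h⟩
    · rintro ⟨p, hp, rfl⟩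
      exact ⟨(hH p hp).1, p, hp, rfl, (hH p hp).2⟩
  have hout : ∀ {B}, B ∈ outH x H ↔ ∃ p ∈ H, p.snd = B := by
    intro B
    simp only [outH, Finset.mem_filter]
    constructor
    · rintro ⟨-, p, hp, h, -⟩
      exact ⟨p, hp, h⟩
    · rintro ⟨p, hp, rfl⟩
      exact ⟨(hH p hp).2, p, hp, rfl, (hH p hp).1⟩
  have hr : ∀ {A B : Finset (Finset QSystem)} (h : A ⊆ B),
      Str.restrict h (strOf B U) = strOf A U := fun _ => rfl
  have hnon : ∀ A : Finset (Finset QSystem),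
      strOf A U ∈ Str.nonOnes A ↔ ∃ a ∈ A, ¬ Disjoint U a := by
    intro A
    rw [Str.nonOnes, Finset.mem_sdiff, Finset.mem_singleton, funext_iff, Subtype.forall]
    simp only [Finset.mem_univ, true_and, not_forall]
    refine exists_congr fun a => ?_
    exact ⟨fun ⟨h, h'⟩ => ⟨h, fun hd => h' ((strOf_eq_one ⟨a, h⟩).mpr hd)⟩,
      fun ⟨h, h'⟩ => ⟨h, fun hd => h' ((strOf_eq_one ⟨a, h⟩).mp hd)⟩⟩
  have heq : ∀ (A B : Finset (Finset QSystem)) (i : A) (j : B),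
      strOf A U i = strOf B U j ↔ (Disjoint U i.1 ↔ Disjoint U j.1) := by
    intro A B i j
    by_cases h1 : Disjoint U i.1 <;> by_cases h2 : Disjoint U j.1 <;> simp [strOf, h1, h2]
  have hones : strOf (x.outputs \ outH x H) U = Str.ones (x.outputs \ outH x H) ↔
      ∀ B ∈ x.outputs, (∀ p ∈ H, p.snd ≠ B) → Disjoint U B := by
    rw [funext_iff, Subtype.forall]
    constructor
    · intro h B hB hne
      have hm : B ∈ x.outputs \ outH x H :=
        Finset.mem_sdiff.mpr ⟨hB, fun h' => by
          obtain ⟨p, hp, hpB⟩ := hout.mp h'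
          exact hne p hp hpB⟩
      exact (strOf_eq_one ⟨B, hm⟩).mp (h B hm)
    · intro h B hm
      obtain ⟨h1, h2⟩ := Finset.mem_sdiff.mp hm
      exact (strOf_eq_one ⟨B, hm⟩).mpr (h B h1 fun p hp hpB => h2 (hout.mpr ⟨p, hp, hpB⟩))
  rw [badStrings, Finset.mem_filter]
  simp only [Finset.mem_univ, true_and, hr]
  constructor
  · rintro ⟨b, hb, c, hc, hbc, rfl, h1, rfl⟩
    rw [hnon] at hb
    obtain ⟨A, hA, hUA⟩ := hb
    obtain ⟨p, hp, rfl⟩ := hin.mp hA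
    refine ⟨⟨p, hp, hUA⟩, fun p hp => ?_, hones.mp h1⟩
    exact (heq _ _ _ _).mp (hbc p hp (hin.mpr ⟨p, hp, rfl⟩) (hout.mpr ⟨p, hp, rfl⟩))
  · rintro ⟨⟨p, hp, hUp⟩, h2, h3⟩
    refine ⟨_, (hnon _).mpr ⟨p.fst, hin.mpr ⟨p, hp, rfl⟩, hUp⟩, _, (hnon _).mpr
      ⟨p.snd, hout.mpr ⟨p, hp, rfl⟩, fun h => hUp ((h2 p hp).mpr h)⟩, fun p hp h k => ?_,
      rfl, hones.mpr h3, rfl⟩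
    exact (heq _ _ _ _).mpr (h2 p hp)

theorem strings_inter_badStrings_eq_empty {x : Ty} (hx : x.Linear) {H : List EquivPair}
    (hH : ∀ p ∈ H, p.fst ∈ x.inputs ∧ p.snd ∈ x.outputs) :
    x.strings ∩ badStrings x H = ∅ ↔ ∀ U, x.good U → ¬ Obstructs x H U := by
  rw [Finset.eq_empty_iff_forall_notMem]
  simp only [Finset.mem_inter, not_and]
  constructor
  · intro h U hU hO
    exact h _ (strOf_mem_strings.mpr hU) ((strOf_mem_badStrings hH).mpr hO)
  · intro h w hw hw'
    obtain ⟨U, rfl⟩ := hx.exists_strOf w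
    exact h U (strOf_mem_strings.mp hw) ((strOf_mem_badStrings hH).mp hw')

theorem strOf_mem_badStringsPair {x : Ty} {p : EquivPair} (h1 : p.fst ∈ x.inputs)
    (h2 : p.snd ∈ x.outputs) {U : Finset QSystem} :
    strOf x.ele U ∈ badStringsPair x p.fst p.snd ↔ Obstructs x [p] U := by
  have hA := inputs_subset x h1
  have hB := outputs_subset x h2
  have hones : strOf (x.outputs \ {p.snd}) U = Str.ones (x.outputs \ {p.snd}) ↔
      ∀ B ∈ x.outputs, p.snd ≠ B → Disjoint U B := by
    rw [funext_iff, Subtype.forall]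
    constructor
    · intro h B hB hne
      have hm : B ∈ x.outputs \ {p.snd} := by simp [hB, hne.symm]
      exact (strOf_eq_one ⟨B, hm⟩).mp (h B hm)
    · intro h B hm
      obtain ⟨h1, h2⟩ := Finset.mem_sdiff.mp hm
      exact (strOf_eq_one ⟨B, hm⟩).mpr (h B h1 fun h => h2 (by simp [h]))
  rw [badStringsPair, Finset.mem_filter]
  have hr : Str.restrict (Finset.sdiff_subset.trans (outputs_subset x)) (strOf x.ele U) =
    strOf (x.outputs \ {p.snd}) U := rfl
  simp only [Finset.mem_univ, true_and, hr, hones, Obstructs, List.mem_singleton, forall_eq,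
    exists_eq_left, hA, hB, forall_true_left, strOf_eq_zero]
  tauto

theorem badStringsPair_eq {x : Ty} (hx : x.Linear) {p : EquivPair} (h1 : p.fst ∈ x.inputs)
    (h2 : p.snd ∈ x.outputs) : badStringsPair x p.fst p.snd = badStrings x [p] := by
  ext w
  obtain ⟨U, rfl⟩ := hx.exists_strOf w
  rw [strOf_mem_badStringsPair h1 h2, strOf_mem_badStrings (by simp [h1, h2])]

/-! ### Contractions of operators -/

theorem contract_add {S : Finset QSystem} (p : EquivPair) (R T : Op S) :
    contract p (R + T) = contract p R + contract p T := by
  ext z w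
  simp [contract, Finset.sum_add_distrib]

theorem contract_smul {S : Finset QSystem} (p : EquivPair) (c : ℂ) (R : Op S) :
    contract p (c • R) = c • contract p R := by
  ext z w
  simp [contract, Finset.mul_sum]

theorem contract_conjTranspose {S : Finset QSystem} (p : EquivPair) (R : Op S) :
    contract p R.conjTranspose = (contract p R).conjTranspose := by
  ext z w
  simp only [contract, Matrix.conjTranspose_apply, star_sum]
  exact Finset.sum_comm

theorem posSemidef_contract {S : Finset QSystem} (p : EquivPair) {R : Op S}
    (hR : R.PosSemidef) : (contract p R).PosSemidef := by
  have h1 := posSemidef_sum_sum (hR.submatrix fun i : Idx p.fst × Idx (S \ (p.fst ∪ p.snd)) =>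
    glue S i.1 (glue (S \ p.fst) (p.iso i.1) i.2))
  convert h1 using 1
  ext z w
  rfl

/-- `contractAll` as a linear map. -/
def contractLin (S : Finset QSystem) : (H : List EquivPair) → Op S →ₗ[ℂ] Op (remaining S H)
  | [] => LinearMap.id
  | p :: H =>
    { toFun := fun R => contract p (contractLin S H R)
      map_add' := fun R T => by rw [map_add, contract_add]; rfl
      map_smul' := fun c R => by rw [map_smul, contract_smul, RingHom.id_apply]; rfl }

theorem contractAll_eq {S : Finset QSystem} (H : List EquivPair) (R : Op S) :
    contractAll H R = contractLin S H R := by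
  induction H with
  | nil => rfl
  | cons p H ih =>
    change contract p (contractAll H R) = contract p (contractLin S H R)
    rw [ih]

theorem contractAll_conjTranspose {S : Finset QSystem} (H : List EquivPair) (R : Op S) :
    contractAll H R.conjTranspose = (contractAll H R).conjTranspose := by
  induction H with
  | nil => rfl
  | cons p H ih =>
    change contract p (contractAll H R.conjTranspose) = (contract p (contractAll H R)).conjTranspose
    rw [ih, contract_conjTranspose]

theorem posSemidef_contractAll {S : Finset QSystem} (H : List EquivPair) {R : Op S}
    (hR : R.PosSemidef) : (contractAll H R).PosSemidef := by
  induction H with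
  | nil => exact hR
  | cons p H ih => exact posSemidef_contract p ih

-- Contraction of product operators

/-- The factor by which a product operator is multiplied when a pair is contracted. -/
noncomputable def contractCoeff (p : EquivPair) (K : Fam) : ℂ :=
  ∑ k : Idx p.fst, ∑ l : Idx p.fst, prodOp K p.fst k l * prodOp K p.snd (p.iso k) (p.iso l)

theorem contract_prodOp {S : Finset QSystem} {p : EquivPair} (h1 : p.fst ⊆ S) (h2 : p.snd ⊆ S)
    (hd : Disjoint p.fst p.snd) (K : Fam) :
    contract p (prodOp K S) = contractCoeff p K • prodOp K (S \ (p.fst ∪ p.snd)) := by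
  have e1 : S = p.fst ∪ S \ p.fst := (Finset.union_sdiff_of_subset h1).symm
  have e2 : S \ p.fst = p.snd ∪ S \ (p.fst ∪ p.snd) := by
    ext q
    have hb : q ∈ p.fst → q ∉ p.snd := fun h => Finset.disjoint_left.mp hd h
    have hc : q ∈ p.snd → q ∈ S := fun h => h2 h
    simp only [Finset.mem_sdiff, Finset.mem_union]
    tauto
  have d1 : Disjoint p.fst (S \ p.fst) := Finset.disjoint_sdiff
  have d2 : Disjoint p.snd (S \ (p.fst ∪ p.snd)) :=
    Finset.disjoint_sdiff.mono_left Finset.subset_union_right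
  ext z w
  simp only [contract, contractCoeff, Matrix.smul_apply, smul_eq_mul, Finset.sum_mul]
  refine Finset.sum_congr rfl fun k _ => Finset.sum_congr rfl fun l _ => ?_
  rw [prodOp_glue K e1 d1, prodOp_glue K e2 d2, mul_assoc]

/-- The pairs of the list are disjoint and made of subsystems of `S`. -/
def Fits (S : Finset QSystem) : List EquivPair → Prop
  | [] => True
  | p :: H => Fits S H ∧ p.fst ⊆ remaining S H ∧ p.snd ⊆ remaining S H ∧ Disjoint p.fst p.snd

theorem contractAll_prodOp {S : Finset QSystem} {H : List EquivPair} (hH : Fits S H) (K : Fam) :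
    contractAll H (prodOp K S) =
      (H.map fun p => contractCoeff p K).prod • prodOp K (remaining S H) := by
  induction H with
  | nil => exact (one_smul ℂ _).symm
  | cons p H ih =>
    obtain ⟨h, h1, h2, hd⟩ := hH
    change contract p (contractAll H (prodOp K S)) = _
    rw [ih h, contract_smul, contract_prodOp h1 h2 hd, smul_smul, List.map_cons, List.prod_cons,
      mul_comm]
    rfl

theorem mem_remaining {S : Finset QSystem} {H : List EquivPair} {q : QSystem} :
    q ∈ remaining S H ↔ q ∈ S ∧ ∀ p ∈ H, q ∉ p.fst ∧ q ∉ p.snd := by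
  induction H with
  | nil => simp [remaining]
  | cons p H ih =>
    simp only [remaining, Finset.mem_sdiff, ih, Finset.mem_union, List.forall_mem_cons]
    tauto

theorem remaining_subset (S : Finset QSystem) (H : List EquivPair) : remaining S H ⊆ S :=
  fun _ hq => (mem_remaining.mp hq).1

theorem contractCoeff_congr {p : EquivPair} {K L : Fam} (h1 : ∀ q ∈ p.fst, K q = L q)
    (h2 : ∀ q ∈ p.snd, K q = L q) : contractCoeff p K = contractCoeff p L := by
  simp only [contractCoeff, prodOp_congr h1, prodOp_congr h2]

theorem contractCoeff_eq_trace_snd {p : EquivPair} {K : Fam} (h : prodOp K p.fst = 1) :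
    contractCoeff p K = (prodOp K p.snd).trace := by
  simp only [contractCoeff, h, Matrix.one_apply, ite_mul, one_mul, zero_mul, Finset.sum_ite_eq,
    Finset.mem_univ, if_true]
  exact p.iso.sum_comp fun k => prodOp K p.snd k k

theorem contractCoeff_eq_trace_fst {p : EquivPair} {K : Fam} (h : prodOp K p.snd = 1) :
    contractCoeff p K = (prodOp K p.fst).trace := by
  simp only [contractCoeff, h, Matrix.one_apply, mul_ite, mul_one, mul_zero,
    EmbeddingLike.apply_eq_iff_eq, Finset.sum_ite_eq, Finset.mem_univ, if_true]
  rfl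

/-- An identity on one member of the pair reduces the coefficient to the trace over the other
member, where a traceless factor occurs. -/
theorem contractCoeff_eq_zero {p : EquivPair} {K : Fam} {U : Finset QSystem} (hK : Adapted K U)
    (h : ¬ (Disjoint U p.fst ↔ Disjoint U p.snd)) : contractCoeff p K = 0 := by
  by_cases h1 : Disjoint U p.fst
  · rw [contractCoeff_eq_trace_snd (hK.eq_one_of_disjoint h1)]
    exact hK.trace_prodOp fun h2 => h (by simp [h1, h2])
  · have h2 : Disjoint U p.snd := by
      by_contra h2
      exact h (by simp [h1, h2])
    rw [contractCoeff_eq_trace_fst (hK.eq_one_of_disjoint h2)]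
    exact hK.trace_prodOp h1

theorem contractCoeff_one (p : EquivPair) {K : Fam} (h1 : prodOp K p.fst = 1)
    (h2 : prodOp K p.snd = 1) : contractCoeff p K = ((∏ q ∈ p.snd, q.dim : ℕ) : ℂ) := by
  rw [contractCoeff_eq_trace_snd h1, h2, trace_one]

/-! ### A product operator that survives the contraction -/

/-- A traceless diagonal operator with entries `1` and `-1`. -/
noncomputable def altMat (q : QSystem) : Matrix (Fin q.dim) (Fin q.dim) ℂ :=
  Matrix.single ⟨0, by have := q.two_le; omega⟩ ⟨0, by have := q.two_le; omega⟩ 1 -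
    Matrix.single ⟨1, q.two_le⟩ ⟨1, q.two_le⟩ 1

theorem trace_altMat (q : QSystem) : (altMat q).trace = 0 := by
  simp [altMat]

theorem conjTranspose_altMat (q : QSystem) : (altMat q).conjTranspose = altMat q := by
  simp [altMat]

theorem sum_altMat (q : QSystem) : ∑ a, ∑ b, altMat q a b * altMat q a b = 2 := by
  simp only [altMat, Matrix.sub_apply, Matrix.single_apply, mul_sub, ite_and, mul_ite, mul_zero,
    Finset.sum_sub_distrib, Finset.sum_ite_eq,
    Finset.mem_univ, if_true, Finset.sum_ite_irrel, Finset.sum_const_zero, mul_one]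
  simp
  norm_num

theorem prodOp_altMat_ne_zero (S : Finset QSystem) : prodOp altMat S ≠ 0 := by
  intro h
  have h1 := congrFun (congrFun h fun i => ⟨0, Nat.pos_of_ne_zero i.1.dim_ne_zero⟩)
    fun i => ⟨0, Nat.pos_of_ne_zero i.1.dim_ne_zero⟩
  simp [prodOp, altMat] at h1

/-- The alternating product on the first member is carried to the second by the basis bijection. The
result is nonzero and traceless but need not be a product, so `L` is chosen among the product
operators that detect it. -/
theorem exists_contractCoeff_ne_zero {p : EquivPair} (hne : p.fst.Nonempty)
    (hd : Disjoint p.fst p.snd) :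
    ∃ V L, Adapted L V ∧ V.Nonempty ∧ V ⊆ p.snd ∧
      contractCoeff p (mix p.snd L altMat) ≠ 0 := by
  let T : Op p.snd := fun b c => prodOp altMat p.fst (p.iso.symm b) (p.iso.symm c)
  have hT : T ≠ 0 := by
    intro h
    refine prodOp_altMat_ne_zero p.fst ?_
    ext a b
    have h1 := congrFun (congrFun h (p.iso a)) (p.iso b)
    simpa [T] using h1
  have hpair : ∀ L, contractCoeff p (mix p.snd L altMat) = pair L T := by
    intro L
    have h1 : prodOp (mix p.snd L altMat) p.fst = prodOp altMat p.fst :=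
      prodOp_congr fun q hq => by simp [mix, Finset.disjoint_left.mp hd hq]
    have h2 : prodOp (mix p.snd L altMat) p.snd = prodOp L p.snd :=
      prodOp_congr fun q hq => by simp [mix, hq]
    rw [contractCoeff, h1, h2, pair, ← p.iso.sum_comp]
    refine Finset.sum_congr rfl fun k _ => ?_
    rw [← p.iso.sum_comp]
    refine Finset.sum_congr rfl fun l _ => ?_
    simp only [T, Equiv.symm_apply_apply]
    ring
  have hex : ∃ k : BasisIdx p.snd, pair (basisFam k) T ≠ 0 := by
    by_contra! h
    refine hT ?_
    rw [eq_sum_basisFam T]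
    exact Finset.sum_eq_zero fun k _ => by rw [h k, mul_zero, zero_smul]
  obtain ⟨k, hk⟩ := hex
  refine ⟨basisSupp k, basisFam k, adapted_basisFam k, ?_, basisSupp_subset k, ?_⟩
  -- With empty support, `L` would be the identity and the coefficient the trace of the alternating
  -- product, which is zero.
  · rw [Finset.nonempty_iff_ne_empty]
    intro h0
    have hA := adapted_basisFam k
    rw [h0] at hA
    rw [← hpair, contractCoeff_eq_trace_fst, trace_prodOp] at hk
    · obtain ⟨q, hq⟩ := hne
      refine hk (Finset.prod_eq_zero hq ?_)
      simp [mix, Finset.disjoint_left.mp hd hq, trace_altMat]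
    · rw [← prodOp_one]
      refine prodOp_congr fun q hq => ?_
      simp [mix, hq, hA.2 q (by simp)]
  · rwa [hpair]

/-- Start from the alternating matrices on `I₀` and treat the pairs one by one: over a pair whose
input lies in `I₀`, add a detecting factor on its output; over the others both members stay trivial
and the coefficient is a dimension. Disjointness of the outputs keeps earlier coefficients intact.
-/
theorem exists_adapted_contractCoeff_ne_zero {I I₀ : Finset QSystem} (hI₀ : I₀ ⊆ I)
    (H : List EquivPair)
    (hH : ∀ p ∈ H, p.fst ⊆ I ∧ Disjoint p.snd I ∧ p.fst.Nonempty ∧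
      (p.fst ⊆ I₀ ∨ Disjoint I₀ p.fst))
    (hp : H.Pairwise fun p q => Disjoint p.snd q.snd) :
    ∃ U K, Adapted K U ∧ (∀ q ∈ U, q ∈ I₀ ∨ ∃ p ∈ H, q ∈ p.snd) ∧ I₀ ⊆ U ∧
      (∀ q ∈ I₀, K q = altMat q) ∧
      ∀ p ∈ H, (Disjoint U p.snd ↔ Disjoint I₀ p.fst) ∧ contractCoeff p K ≠ 0 := by
  induction H with
  | nil =>
    refine ⟨I₀, mix I₀ altMat 1, ⟨fun q hq => by simp [mix, hq, trace_altMat],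
      fun q hq => by simp [mix, hq]⟩, fun q hq => Or.inl hq, subset_rfl,
      fun q hq => by simp [mix, hq], by simp⟩
  | cons p H ih =>
    rw [List.pairwise_cons] at hp
    rw [List.forall_mem_cons] at hH
    obtain ⟨⟨hpI, hpd, hpn, hpI₀⟩, hH⟩ := hH
    obtain ⟨U, K, hK, hU, hIU, hKalt, hc⟩ := ih hH hp.2
    have hUp : Disjoint U p.snd := by
      rw [Finset.disjoint_left]
      intro q hq hqp
      rcases hU q hq with h | ⟨p', hp', hqp'⟩
      · exact Finset.disjoint_left.mp hpd hqp (hI₀ h)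
      · exact Finset.disjoint_left.mp (hp.1 p' hp') hqp hqp'
    have hUI : ∀ q ∈ U, q ∈ I → q ∈ I₀ := by
      intro q hq hqI
      rcases hU q hq with h | ⟨p', hp', hqp'⟩
      · exact h
      · exact absurd hqI (Finset.disjoint_left.mp (hH p' hp').2.1 hqp')
    have hd : Disjoint p.fst p.snd := hpd.symm.mono_left hpI
    rcases hpI₀ with hact | hin
    · obtain ⟨V, L, hL, hVn, hVs, hLc⟩ := exists_contractCoeff_ne_zero hpn hd
      refine ⟨U ∪ V, mix p.snd L K, ⟨?_, ?_⟩, ?_, hIU.trans Finset.subset_union_left, ?_, ?_⟩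
      · intro q hq
        by_cases hqp : q ∈ p.snd
        · have : q ∉ U := Finset.disjoint_right.mp hUp hqp
          simpa [mix, hqp] using hL.1 q ((Finset.mem_union.mp hq).resolve_left this)
        · have : q ∉ V := fun h => hqp (hVs h)
          simpa [mix, hqp] using hK.1 q ((Finset.mem_union.mp hq).resolve_right this)
      · intro q hq
        rw [Finset.mem_union, not_or] at hq
        by_cases hqp : q ∈ p.snd
        · simpa [mix, hqp] using hL.2 q hq.2
        · simpa [mix, hqp] using hK.2 q hq.1
      · intro q hq
        rcases Finset.mem_union.mp hq with h | h
        · rcases hU q h with h | ⟨p', hp', h⟩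
          · exact Or.inl h
          · exact Or.inr ⟨p', List.mem_cons_of_mem _ hp', h⟩
        · exact Or.inr ⟨p, List.mem_cons_self, hVs h⟩
      · intro q hq
        have : q ∉ p.snd := Finset.disjoint_right.mp hpd (hI₀ hq)
        simp [mix, this, hKalt q hq]
      · rw [List.forall_mem_cons]
        refine ⟨⟨?_, ?_⟩, fun p' hp' => ⟨?_, ?_⟩⟩
        · constructor
          · intro h
            obtain ⟨q, hq⟩ := hVn
            exact absurd (hVs hq) (Finset.disjoint_left.mp h (Finset.mem_union_right _ hq))
          · intro h
            obtain ⟨q, hq⟩ := hpn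
            exact absurd hq (Finset.disjoint_left.mp h (hact hq))
        · rw [contractCoeff_congr (L := mix p.snd L altMat)]
          · exact hLc
          · intro q hq
            simp [mix, Finset.disjoint_left.mp hd hq, hKalt q (hact hq)]
          · intro q hq
            simp [mix, hq]
        · rw [← (hc p' hp').1, Finset.disjoint_union_left]
          exact and_iff_left ((hp.1 p' hp').mono_left hVs)
        · rw [contractCoeff_congr (L := K)]
          · exact (hc p' hp').2
          · intro q hq
            have : q ∉ p.snd := Finset.disjoint_right.mp hpd ((hH p' hp').1 hq)
            simp [mix, this]
          · intro q hq
            have : q ∉ p.snd := Finset.disjoint_right.mp (hp.1 p' hp') hq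
            simp [mix, this]
    · refine ⟨U, K, hK, fun q hq => ?_, hIU, hKalt, ?_⟩
      · rcases hU q hq with h | ⟨p', hp', h⟩
        · exact Or.inl h
        · exact Or.inr ⟨p', List.mem_cons_of_mem _ hp', h⟩
      · rw [List.forall_mem_cons]
        refine ⟨⟨by simp [hUp, hin], ?_⟩, hc⟩
        rw [contractCoeff_one p (hK.eq_one_of_disjoint ?_) (hK.eq_one_of_disjoint hUp)]
        · exact Nat.cast_ne_zero.mpr (Ty.prod_dim_ne_zero _)
        · rw [Finset.disjoint_left]
          intro q hq hqf
          exact Finset.disjoint_left.mp hin (hUI q hq (hpI hqf)) hqf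

/-! ### Admissible contractions -/

theorem Ty.Linear.disjoint_of_inputs_outputs {x : Ty} (hx : x.Linear) {A B : Finset QSystem}
    (hA : A ∈ x.inputs) (hB : B ∈ x.outputs) : Disjoint A B :=
  hx.disjoint_inSys_outSys.mono (Ty.subset_inSys hA) (Ty.subset_outSys hB)

theorem Ty.Linear.fits {x : Ty} (hx : x.Linear) {H : List EquivPair}
    (hH : ∀ p ∈ H, p.fst ∈ x.inputs ∧ p.snd ∈ x.outputs)
    (hp : H.Pairwise fun p q => p.fst ≠ q.fst ∧ p.snd ≠ q.snd) : Fits x.systems H := by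
  induction H with
  | nil => trivial
  | cons p H ih =>
    rw [List.pairwise_cons] at hp
    rw [List.forall_mem_cons] at hH
    obtain ⟨⟨h1, h2⟩, hH⟩ := hH
    have e1 := inputs_subset x h1
    have e2 := outputs_subset x h2
    refine ⟨ih hH hp.2, fun q hq => mem_remaining.mpr ⟨Ty.subset_systems_of_mem_ele e1 hq,
      fun p' hp' => ⟨?_, ?_⟩⟩, fun q hq => mem_remaining.mpr
      ⟨Ty.subset_systems_of_mem_ele e2 hq, fun p' hp' => ⟨?_, ?_⟩⟩,
      hx.disjoint_of_inputs_outputs h1 h2⟩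
    · exact Finset.disjoint_left.mp
        (hx.disjoint_ele e1 (inputs_subset x (hH p' hp').1) (hp.1 p' hp').1) hq
    · exact Finset.disjoint_left.mp (hx.disjoint_of_inputs_outputs h1 (hH p' hp').2) hq
    · exact Finset.disjoint_right.mp (hx.disjoint_of_inputs_outputs (hH p' hp').1 h2) hq
    · exact Finset.disjoint_left.mp
        (hx.disjoint_ele e2 (outputs_subset x (hH p' hp').2) (hp.1 p' hp').2) hq

-- Systems and dimensions left by a contraction

namespace Ty

/-- The input systems that are left by a contraction. -/
def inRest (x : Ty) (H : List EquivPair) : Finset QSystem := x.inSys ∩ remaining x.systems H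

/-- The output systems that are left by a contraction. -/
def outRest (x : Ty) (H : List EquivPair) : Finset QSystem := x.outSys ∩ remaining x.systems H

theorem remaining_eq (x : Ty) (H : List EquivPair) :
    remaining x.systems H = x.inRest H ∪ x.outRest H := by
  rw [inRest, outRest, ← Finset.union_inter_distrib_right, ← systems_eq,
    Finset.inter_eq_right.mpr (remaining_subset _ _)]

theorem Linear.disjoint_inRest_outRest {x : Ty} (hx : x.Linear) (H : List EquivPair) :
    Disjoint (x.inRest H) (x.outRest H) :=
  hx.disjoint_inSys_outSys.mono Finset.inter_subset_left Finset.inter_subset_left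

theorem Linear.prod_dim_outRest {x : Ty} (hx : x.Linear) {H : List EquivPair}
    (hH : ∀ p ∈ H, p.fst ∈ x.inputs ∧ p.snd ∈ x.outputs) (hf : Fits x.systems H) :
    (H.map fun p => ∏ q ∈ p.snd, q.dim).prod * ∏ q ∈ x.outRest H, q.dim = x.outDim := by
  induction H with
  | nil => simp [outRest, remaining, Finset.inter_eq_left.mpr x.outSys_subset, outDim]
  | cons p H ih =>
    rw [List.forall_mem_cons] at hH
    obtain ⟨⟨h1, h2⟩, hH⟩ := hH
    obtain ⟨hf, -, hs, -⟩ := hf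
    rw [← ih hH hf, List.map_cons, List.prod_cons]
    have e : x.outRest H = p.snd ∪ x.outRest (p :: H) := by
      ext q
      have a1 : q ∈ p.snd → q ∈ x.outSys := fun h => subset_outSys h2 h
      have a2 : q ∈ p.snd → q ∈ remaining x.systems H := fun h => hs h
      have a3 : q ∈ p.fst → q ∉ x.outSys :=
        fun h => Finset.disjoint_left.mp hx.disjoint_inSys_outSys (subset_inSys h1 h)
      simp only [outRest, remaining, Finset.mem_inter, Finset.mem_union, Finset.mem_sdiff]
      tauto
    have hd : Disjoint p.snd (x.outRest (p :: H)) := by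
      rw [Finset.disjoint_left]
      intro q hq h
      exact ((mem_remaining.mp (Finset.mem_inter.mp h).2).2 p List.mem_cons_self).2 hq
    rw [e, Finset.prod_union hd]
    ring

end Ty

/-- The factor by which the identity is multiplied in a contraction. -/
def contractDim (H : List EquivPair) : ℕ := (H.map fun p => ∏ q ∈ p.snd, q.dim).prod

theorem contractAll_prodOp_of_disjoint {S : Finset QSystem} {H : List EquivPair} (hf : Fits S H)
    {K : Fam} {U : Finset QSystem} (hK : Adapted K U)
    (hU : ∀ p ∈ H, Disjoint U p.fst ∧ Disjoint U p.snd) :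
    contractAll H (prodOp K S) = (contractDim H : ℂ) • prodOp K (remaining S H) := by
  rw [contractAll_prodOp hf, contractDim, Nat.cast_list_prod, List.map_map]
  congr 2
  exact List.map_congr_left fun p hp => contractCoeff_one p
    (hK.eq_one_of_disjoint (hU p hp).1) (hK.eq_one_of_disjoint (hU p hp).2)

theorem contractAll_one {S : Finset QSystem} {H : List EquivPair} (hf : Fits S H) :
    contractAll H (1 : Op S) = (contractDim H : ℂ) • (1 : Op (remaining S H)) := by
  have h := contractAll_prodOp_of_disjoint hf adapted_one (by simp)
  rwa [prodOp_one, prodOp_one] at h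

theorem trace_contractAll_smul_one {x : Ty} (hx : x.Linear) {H : List EquivPair}
    (hH : ∀ p ∈ H, p.fst ∈ x.inputs ∧ p.snd ∈ x.outputs) (hf : Fits x.systems H) :
    (contractAll H (((1 / x.outDim : ℝ) : ℂ) • (1 : Op x.systems))).trace =
      ((∏ q ∈ x.inRest H, q.dim : ℕ) : ℂ) := by
  rw [contractAll_eq, map_smul, ← contractAll_eq, contractAll_one hf, Matrix.trace_smul,
    Matrix.trace_smul, trace_one, x.remaining_eq, Finset.prod_union (hx.disjoint_inRest_outRest H)]
  have h : contractDim H * _ = _ := hx.prod_dim_outRest hH hf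
  have h0 := x.outDim_ne_zero
  have h' : (contractDim H : ℂ) * ((∏ q ∈ x.outRest H, q.dim : ℕ) : ℂ) = x.outDim := by
    rw [← Nat.cast_mul, h]
  simp only [smul_eq_mul, Nat.cast_mul, Complex.ofReal_div, Complex.ofReal_one,
    Complex.ofReal_natCast]
  field_simp
  linear_combination ((∏ q ∈ x.inRest H, q.dim : ℕ) : ℂ) * h'

-- Sufficiency of the string condition

/-- If no allowed component obstructs the contraction, then the contracted operators are
channels from the remaining inputs to the remaining outputs. -/
theorem isDet_contractAll {x : Ty} (hx : x.Linear) {H : List EquivPair}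
    (hH : ∀ p ∈ H, p.fst ∈ x.inputs ∧ p.snd ∈ x.outputs) (hf : Fits x.systems H)
    (h : ∀ U, x.good U → ¬ Obstructs x H U) {R : Op x.systems} (hR : IsDet x R) :
    IsDet (Ty.arrow (Ty.elem (x.inRest H)) (Ty.elem (x.outRest H))) (contractAll H R) := by
  -- Tested on a component trivial on the remaining outputs, every non-identity term of `R`
  -- vanishes: it is forbidden in `R`, mismatched on a pair, or orthogonal to `K`. The only other
  -- possibility is excluded by the absence of obstructions.
  have hterm : ∀ {K V}, Adapted K V → Disjoint V (x.outRest H) → ∀ k : BasisIdx x.systems,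
      k ≠ (fun _ => none) →
      pair (basisFam k) R * pair K (contractAll H (prodOp (basisFam k) x.systems)) = 0 := by
    intro K V hK hV k hk
    have hA := adapted_basisFam k
    obtain ⟨q₀, hq₀⟩ := basisSupp_nonempty hk
    by_cases hg : x.good (basisSupp k)
    swap
    · rw [hR.allowed _ _ hA (Finset.not_disjoint_iff.mpr ⟨q₀, hq₀, basisSupp_subset k hq₀⟩) hg,
        zero_mul]
    rw [contractAll_prodOp hf, pair_smul]
    by_cases hm : ∀ p ∈ H, (Disjoint (basisSupp k) p.fst ↔ Disjoint (basisSupp k) p.snd)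
    swap
    · rw [not_forall₂] at hm
      obtain ⟨p, hp, hne⟩ := hm
      rw [List.prod_eq_zero (List.mem_map.mpr ⟨p, hp, contractCoeff_eq_zero hA hne⟩), zero_mul,
        mul_zero]
    by_cases ho : Disjoint (basisSupp k) (x.outRest H)
    swap
    · obtain ⟨q, h1, h2⟩ := Finset.not_disjoint_iff.mp ho
      rw [pair_prodOp_eq_zero hK hA ⟨q, (Finset.mem_inter.mp h2).2, ?_⟩, mul_zero, mul_zero]
      simp [h1, Finset.disjoint_right.mp hV h2]
    exfalso
    have hB : ∀ B ∈ x.outputs, (∀ p ∈ H, p.snd ≠ B) → Disjoint (basisSupp k) B := by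
      intro B hB hne
      refine ho.mono_right fun q hq => Finset.mem_inter.mpr ⟨Ty.subset_outSys hB hq, ?_⟩
      refine mem_remaining.mpr ⟨Ty.subset_systems_of_mem_ele (outputs_subset x hB) hq,
        fun p hp => ⟨?_, ?_⟩⟩
      · exact Finset.disjoint_right.mp (hx.disjoint_of_inputs_outputs (hH p hp).1 hB) hq
      · exact Finset.disjoint_right.mp
          (hx.disjoint_ele (outputs_subset x (hH p hp).2) (outputs_subset x hB) (hne p hp)) hq
    -- Meeting a contracted input would make the support an obstruction. Without that it misses
    -- every output and cannot be good.
    have hnone : ∀ p ∈ H, Disjoint (basisSupp k) p.fst := by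
      by_contra hc
      push Not at hc
      exact h _ hg ⟨hc, hm, hB⟩
    refine (Ty.good_of_disjoint_and_not_good (basisSupp k)).2 ?_ hg
    rw [Finset.disjoint_left]
    intro q hq hqo
    refine Finset.disjoint_left.mp ho hq (Finset.mem_inter.mpr ⟨hqo, mem_remaining.mpr
      ⟨x.outSys_subset hqo, fun p hp => ⟨?_, ?_⟩⟩⟩)
    · exact Finset.disjoint_left.mp (hnone p hp) hq
    · exact Finset.disjoint_left.mp ((hm p hp).mp (hnone p hp)) hq
  have hpair : ∀ {K V}, Adapted K V → Disjoint V (x.outRest H) →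
      pair K (contractAll H R) =
        pair K (contractAll H (((1 / x.outDim : ℝ) : ℂ) • (1 : Op x.systems))) := by
    intro K V hK hV
    conv_lhs => rw [eq_sum_basisFam R, contractAll_eq, map_sum, pair_sum]
    rw [Finset.sum_eq_single fun _ => none]
    · rw [basisFam_none, pair_one_left, prodOp_one, hR.trace, basisCoeff_none, hx.prod_dim,
        contractAll_eq]
      congr 3
      have h1 := x.outDim_ne_zero
      have h2 : (x.inDim : ℂ) ≠ 0 := Nat.cast_ne_zero.mpr (Ty.prod_dim_ne_zero _)
      push_cast
      field_simp
    · intro k _ hk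
      rw [map_smul, pair_smul, ← contractAll_eq, mul_assoc, hterm hK hV k hk, mul_zero]
    · simp
  refine ⟨posSemidef_contractAll H hR.pos, ?_, ?_⟩
  · rw [← pair_one_left, hpair adapted_one (by simp), pair_one_left,
      trace_contractAll_smul_one hx hH hf]
    simp [Ty.inDim, Ty.inSys, Ty.outSys]
  · intro V K hK hVne hg
    simp only [Ty.good, not_or, not_not] at hg
    rw [hpair hK hg.1, contractAll_eq, map_smul, ← contractAll_eq, contractAll_one hf, pair_smul,
      pair_smul, hK.pair_one hVne, mul_zero, mul_zero]

theorem multiContractionAdmissible_of_not_obstructs {x : Ty} (hx : x.Linear) {H : List EquivPair}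
    (hH : ∀ p ∈ H, p.fst ∈ x.inputs ∧ p.snd ∈ x.outputs) (hf : Fits x.systems H)
    (h : ∀ U, x.good U → ¬ Obstructs x H U) : MultiContractionAdmissible x H := by
  intro R hR
  have hz : (Ty.arrow (Ty.elem (x.inRest H)) (Ty.elem (x.outRest H))).Linear :=
    ⟨trivial, trivial, hx.disjoint_inRest_outRest H⟩
  refine ⟨_, hz, (isDeterministicOfType_iff hz).mpr ⟨x.remaining_eq H, ?_⟩⟩
  exact isDet_contractAll hx hH hf h ((mem_deterministicMaps hx).mp hR)

-- Necessity of the string condition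

theorem trace_eq_of_isDeterministicOfType {S : Finset QSystem} {R : Op S} {z : Ty}
    (hz : z.Linear) (h : IsDeterministicOfType R z) : R.trace = z.inDim :=
  ((isDeterministicOfType_iff hz).mp h).2.trace

/-- A Hermitian operator with allowed components whose contraction is a nonzero product
operator. -/
theorem exists_obstruction {x : Ty} (hx : x.Linear) {H : List EquivPair}
    (hH : ∀ p ∈ H, p.fst ∈ x.inputs ∧ p.snd ∈ x.outputs)
    (hp : H.Pairwise fun p q => p.fst ≠ q.fst ∧ p.snd ≠ q.snd) {U₀ : Finset QSystem}
    (hg : x.good U₀) (hO : Obstructs x H U₀) :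
    ∃ (U : Finset QSystem) (K : Fam) (T : Op x.systems) (c : ℝ), Adapted K U ∧
      Disjoint U (x.outRest H) ∧ (∀ q ∈ remaining x.systems H, q ∈ U → K q = altMat q) ∧
      T.IsHermitian ∧ T.trace = 0 ∧ Allowed x T ∧ 0 < c ∧
      contractAll H T = (c : ℂ) • prodOp K (remaining x.systems H) := by
  have hf := hx.fits hH hp
  -- The obstruction is enlarged to whole input types, so that each contracted input lies inside
  -- `I₀` or is disjoint from it.
  let I₀ : Finset QSystem := x.inSys.filter fun q => ∃ A ∈ x.inputs, q ∈ A ∧ ¬ Disjoint U₀ A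
  have hI₀ : ∀ A ∈ x.inputs, (¬ Disjoint U₀ A → A ⊆ I₀) ∧ (Disjoint U₀ A → Disjoint I₀ A) := by
    intro A hA
    refine ⟨fun h q hq => Finset.mem_filter.mpr ⟨Ty.subset_inSys hA hq, A, hA, hq, h⟩,
      fun h => Finset.disjoint_left.mpr fun q hq hqA => ?_⟩
    obtain ⟨-, B, hB, hqB, hUB⟩ := Finset.mem_filter.mp hq
    have hAB : A ≠ B := fun h' => hUB (h' ▸ h)
    exact Finset.disjoint_left.mp
      (hx.disjoint_ele (inputs_subset x hA) (inputs_subset x hB) hAB) hqA hqB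
  have hI₀' : ∀ A ∈ x.inputs, (Disjoint I₀ A ↔ Disjoint U₀ A) := by
    intro A hA
    refine ⟨fun h => ?_, (hI₀ A hA).2⟩
    by_contra hne
    obtain ⟨q, hq⟩ := Ty.nonempty_of_mem_ele (inputs_subset x hA)
    exact Finset.disjoint_left.mp h ((hI₀ A hA).1 hne hq) hq
  have hI₀s : I₀ ⊆ x.inSys := Finset.filter_subset _ _
  obtain ⟨U, K, hK, hU, hIU, hKalt, hc⟩ := exists_adapted_contractCoeff_ne_zero hI₀s H
    (fun p hpH => ⟨Ty.subset_inSys (hH p hpH).1,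
      (hx.disjoint_inSys_outSys.mono_right (Ty.subset_outSys (hH p hpH).2)).symm,
      Ty.nonempty_of_mem_ele (inputs_subset x (hH p hpH).1),
      or_iff_not_imp_right.mpr fun h => (hI₀ _ (hH p hpH).1).1
        fun h' => h ((hI₀ _ (hH p hpH).1).2 h')⟩)
    (hp.imp_of_mem fun {p q} hpm hqm h => hx.disjoint_ele (outputs_subset x (hH p hpm).2)
      (outputs_subset x (hH q hqm).2) h.2)
  have hUrem : ∀ q ∈ remaining x.systems H, q ∈ U → q ∈ I₀ := by
    intro q hq hqU
    rcases hU q hqU with h | ⟨p, hpH, h⟩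
    · exact h
    · exact absurd h ((mem_remaining.mp hq).2 p hpH).2
  have hUout : ∀ q ∈ x.outSys, q ∈ U → ∃ p ∈ H, q ∈ p.snd := by
    intro q hq hqU
    rcases hU q hqU with h | h
    · exact absurd hq (Finset.disjoint_left.mp hx.disjoint_inSys_outSys (hI₀s h))
    · exact h
  -- `U` and `U₀` meet the same elementary types, although they may differ inside them.
  have hgU : x.good U := by
    refine (Ty.good_iff_of_ele fun A hA => ?_).mpr hg
    rcases Ty.mem_inputs_or_mem_outputs hA with hA | hA
    · rw [← hI₀' A hA]
      refine ⟨fun h => h.mono_left hIU, fun h => Finset.disjoint_left.mpr fun q hq hqA => ?_⟩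
      rcases hU q hq with h' | ⟨p, hpH, h'⟩
      · exact Finset.disjoint_left.mp h h' hqA
      · exact Finset.disjoint_left.mp (hx.disjoint_of_inputs_outputs hA (hH p hpH).2) hqA h'
    · by_cases hex : ∃ p ∈ H, p.snd = A
      · obtain ⟨p, hpH, rfl⟩ := hex
        rw [(hc p hpH).1, hI₀' _ (hH p hpH).1, hO.2.1 p hpH]
      · push Not at hex
        refine iff_of_true (Finset.disjoint_left.mpr fun q hq hqA => ?_) (hO.2.2 A hA hex)
        obtain ⟨p, hpH, h'⟩ := hUout q (Ty.subset_outSys hA hqA) hq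
        exact Finset.disjoint_left.mp (hx.disjoint_ele (outputs_subset x (hH p hpH).2)
          (outputs_subset x hA) (hex p hpH)) h' hqA
  have hd : ¬ Disjoint U x.systems := fun h => Ty.not_good_of_disjoint h hgU
  let κ : ℂ := (H.map fun p => contractCoeff p K).prod
  have hκ : κ ≠ 0 := by
    refine List.prod_ne_zero fun h => ?_
    obtain ⟨p, hpH, h0⟩ := List.mem_map.mp h
    exact (hc p hpH).2 h0
  let K' : Fam := fun q => (K q).conjTranspose
  have hK' : Adapted K' U := hK.conjTranspose
  have hconj : ∀ S, (prodOp K S).conjTranspose = prodOp K' S := conjTranspose_prodOp K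
  have hherm : (prodOp K (remaining x.systems H)).conjTranspose =
      prodOp K (remaining x.systems H) := by
    rw [hconj]
    refine prodOp_congr fun q hq => ?_
    by_cases hqU : q ∈ U
    · simp only [K', hKalt q (hUrem q hq hqU), conjTranspose_altMat]
    · simp [K', hK.2 q hqU]
  -- The product operator contracts to `κ` times a Hermitian product operator, so weighting it by
  -- `star κ` and adding the adjoint yields a positive factor `2 * |κ| ^ 2`.
  refine ⟨U, K, star κ • prodOp K x.systems + κ • (prodOp K x.systems).conjTranspose,
    2 * Complex.normSq κ, hK, ?_, fun q hq hqU => hKalt q (hUrem q hq hqU), ?_, ?_, ?_, ?_, ?_⟩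
  · rw [Finset.disjoint_right]
    intro q hq hqU
    obtain ⟨h1, h2⟩ := Finset.mem_inter.mp hq
    exact Finset.disjoint_left.mp hx.disjoint_inSys_outSys (hI₀s (hUrem q h2 hqU)) h1
  · rw [Matrix.IsHermitian, Matrix.conjTranspose_add, Matrix.conjTranspose_smul,
      Matrix.conjTranspose_smul, Matrix.conjTranspose_conjTranspose, star_star, add_comm]
  · rw [Matrix.trace_add, Matrix.trace_smul, Matrix.trace_smul, hconj, hK.trace_prodOp hd,
      hK'.trace_prodOp hd, smul_zero, smul_zero, add_zero]
  · rw [hconj]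
    exact ((hK.allowed subset_rfl hgU).smul _).add ((hK'.allowed subset_rfl hgU).smul _)
  · have := Complex.normSq_pos.mpr hκ
    positivity
  · rw [contractAll_eq, map_add, map_smul, map_smul, ← contractAll_eq, ← contractAll_eq,
      contractAll_conjTranspose, contractAll_prodOp hf, Matrix.conjTranspose_smul, hherm,
      smul_smul, smul_smul, ← add_smul]
    congr 1
    change star κ * κ + κ * star κ = _
    rw [mul_comm (star κ), ← two_mul, Complex.star_def, Complex.mul_conj]
    push_cast
    rfl

/-- The type `z` is arbitrary, so only facts common to all types can be used: the trace is the
integer `z.inDim`, and a nontrivial component must meet some output of `z`. -/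
theorem not_obstructs_of_multiContractionAdmissible {x : Ty} (hx : x.Linear)
    {H : List EquivPair} (hH : ∀ p ∈ H, p.fst ∈ x.inputs ∧ p.snd ∈ x.outputs)
    (hp : H.Pairwise fun p q => p.fst ≠ q.fst ∧ p.snd ≠ q.snd)
    (hadm : MultiContractionAdmissible x H) {U₀ : Finset QSystem} (hg : x.good U₀) :
    ¬ Obstructs x H U₀ := by
  intro hO
  obtain ⟨U, K, T, c, hK, hUo, hKalt, hT, hTt, hTa, hc, hcT⟩ := exists_obstruction hx hH hp hg hO
  have hf := hx.fits hH hp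
  have htr1 := trace_contractAll_smul_one hx hH hf
  by_cases hU : Disjoint U (remaining x.systems H)
  · -- the trace of the contracted operator can be perturbed
    obtain ⟨r, hr, hpos⟩ := exists_smul_one_add_smul_posSemidef hT (one_div_outDim_pos x)
    let m : ℝ := c * ((∏ q ∈ remaining x.systems H, q.dim : ℕ) : ℝ)
    have hm : 0 < m := mul_pos hc
      (by exact_mod_cast Nat.pos_of_ne_zero (Ty.prod_dim_ne_zero _))
    -- The first bound keeps the operator positive; the second makes the trace shift `s * m` lie
    -- strictly between 0 and 1, hence non-integer.
    let s : ℝ := min r (1 / (2 * m))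
    have hs : 0 < s := lt_min hr (by positivity)
    have hsm : s * m < 1 := by
      have h1 : s ≤ 1 / (2 * m) := min_le_right _ _
      calc s * m ≤ 1 / (2 * m) * m := by gcongr
        _ = 1 / 2 := by field_simp
        _ < 1 := by norm_num
    obtain ⟨z, hz, hdet⟩ := hadm _ ((mem_deterministicMaps hx).mpr (isDet_smul_one_add hx
      (H := (s : ℂ) • T) (by rw [Matrix.trace_smul, hTt, smul_zero]) (hTa.smul _)
      (hpos s hs.le (min_le_left _ _))))
    have h1 := trace_eq_of_isDeterministicOfType hz hdet
    rw [contractAll_eq, map_add, map_smul (contractLin _ _) (s : ℂ), Matrix.trace_add,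
      ← contractAll_eq, ← contractAll_eq, htr1, hcT, hK.eq_one_of_disjoint hU, Matrix.trace_smul,
      Matrix.trace_smul, trace_one] at h1
    have h2 : ((∏ q ∈ x.inRest H, q.dim : ℕ) : ℝ) + s * m = (z.inDim : ℝ) := by
      have h3 : (((((∏ q ∈ x.inRest H, q.dim : ℕ) : ℝ) + s * m : ℝ)) : ℂ) =
          (((z.inDim : ℝ)) : ℂ) := by
        simp only [m, Complex.ofReal_add, Complex.ofReal_mul, Complex.ofReal_natCast]
        exact h1
      exact_mod_cast h3
    have h4 : (∏ q ∈ x.inRest H, q.dim) < z.inDim := by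
      have : ((∏ q ∈ x.inRest H, q.dim : ℕ) : ℝ) < (z.inDim : ℝ) := by
        rw [← h2]
        exact lt_add_of_pos_right _ (mul_pos hs hm)
      exact_mod_cast this
    have h5 : z.inDim < (∏ q ∈ x.inRest H, q.dim) + 1 := by
      have : (z.inDim : ℝ) < ((∏ q ∈ x.inRest H, q.dim : ℕ) : ℝ) + 1 := by
        rw [← h2]
        exact add_lt_add_right hsm _
      exact_mod_cast this
    omega
  · -- the remaining outputs are outputs of every possible type
    let Z : QSystem → Fam := fun q => mix {q} altMat 1
    have hZ : ∀ q, Adapted (Z q) {q} := by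
      intro q
      refine ⟨fun p hp => ?_, fun p hp => by simp [Z, mix, hp]⟩
      simp [Z, mix, hp, trace_altMat]
    have hZg : ∀ q ∈ x.outRest H, x.good {q} := by
      intro q hq
      have hqo := (Finset.mem_inter.mp hq).1
      refine (Ty.good_of_disjoint_and_not_good {q}).1 ?_ (by simpa using hqo)
      simpa using Finset.disjoint_right.mp hx.disjoint_inSys_outSys hqo
    -- One traceless component per remaining output. Each survives contraction by itself and forces
    -- its system to be an output of `z`.
    let D : Op x.systems := ∑ q ∈ x.outRest H, prodOp (Z q) x.systems
    have hD : D.IsHermitian := by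
      have : ∀ q, (prodOp (Z q) x.systems).conjTranspose = prodOp (Z q) x.systems := by
        intro q
        rw [conjTranspose_prodOp]
        refine prodOp_congr fun p _ => ?_
        by_cases hp : p = q <;> simp [Z, mix, hp, conjTranspose_altMat]
      simp only [D, Matrix.IsHermitian, Matrix.conjTranspose_sum, this]
    have hDt : D.trace = 0 := by
      rw [Matrix.trace_sum]
      refine Finset.sum_eq_zero fun q hq => (hZ q).trace_prodOp fun h => ?_
      exact Ty.not_good_of_disjoint h (hZg q hq)
    have hDa : Allowed x D := Allowed.sum fun q hq => (hZ q).allowed subset_rfl (hZg q hq)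
    obtain ⟨r, hr, hpos⟩ :=
      exists_smul_one_add_smul_posSemidef (hD.add hT) (one_div_outDim_pos x)
    obtain ⟨z, hz, hdet⟩ := hadm _ ((mem_deterministicMaps hx).mpr (isDet_smul_one_add hx
      (H := (r : ℂ) • (D + T)) (by rw [Matrix.trace_smul, Matrix.trace_add, hDt, hTt]; simp)
      ((hDa.add hTa).smul _) (hpos r hr.le le_rfl)))
    obtain ⟨hzs, hdet⟩ := (isDeterministicOfType_iff hz).mp hdet
    have hcD : contractAll H D =
        (contractDim H : ℂ) • ∑ q ∈ x.outRest H, prodOp (Z q) (remaining x.systems H) := by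
      rw [contractAll_eq, map_sum, Finset.smul_sum]
      refine Finset.sum_congr rfl fun q hq => ?_
      rw [← contractAll_eq, contractAll_prodOp_of_disjoint hf (hZ q)]
      intro p hp
      have := (mem_remaining.mp (Finset.mem_inter.mp hq).2).2 p hp
      simpa using this
    have hexp : contractAll H (((1 / x.outDim : ℝ) : ℂ) • (1 : Op x.systems) + (r : ℂ) • (D + T)) =
        contractAll H (((1 / x.outDim : ℝ) : ℂ) • (1 : Op x.systems)) +
          (r : ℂ) • ((contractDim H : ℂ) • ∑ q ∈ x.outRest H, prodOp (Z q) (remaining x.systems H) +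
            (c : ℂ) • prodOp K (remaining x.systems H)) := by
      rw [← hcD, ← hcT]
      simp only [contractAll_eq, map_add, map_smul]
    have hone : ∀ {L V}, Adapted L V → ¬ Disjoint V (remaining x.systems H) →
        pair L (contractAll H (((1 / x.outDim : ℝ) : ℂ) • (1 : Op x.systems))) = 0 := by
      intro L V hL hV
      rw [contractAll_eq, map_smul, ← contractAll_eq, contractAll_one hf, pair_smul, pair_smul,
        hL.pair_one hV, mul_zero, mul_zero]
    have hr0 : (r : ℂ) ≠ 0 := by exact_mod_cast hr.ne'
    have hc0 : (c : ℂ) ≠ 0 := by exact_mod_cast hc.ne'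
    have hself : ∀ {L : Fam} {V : Finset QSystem}, Adapted L V →
        (∀ q ∈ remaining x.systems H, q ∈ V → L q = altMat q) →
        pair L (prodOp L (remaining x.systems H)) ≠ 0 := by
      intro L V hL halt
      rw [pair_prodOp, Finset.prod_ne_zero_iff]
      intro q hq
      by_cases hqV : q ∈ V
      · rw [halt q hq hqV, sum_altMat]
        norm_num
      · have : (q.dim : ℂ) ≠ 0 := Nat.cast_ne_zero.mpr q.dim_ne_zero
        simpa [hL.2 q hqV, Matrix.one_apply] using this
    have hout : x.outRest H ⊆ z.outSys := by
      intro q hq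
      have hqr := (Finset.mem_inter.mp hq).2
      have hqd : ¬ Disjoint {q} (remaining x.systems H) := by simpa using hqr
      by_contra hqz
      have h1 := hdet.allowed {q} (Z q) (hZ q) hqd
        ((Ty.good_of_disjoint_and_not_good {q}).2 (by simpa using hqz))
      rw [hexp, pair_add, hone (hZ q) hqd, zero_add, pair_smul, pair_add, pair_smul, pair_smul,
        pair_sum, Finset.sum_eq_single_of_mem q hq, pair_prodOp_eq_zero (hZ q) hK ⟨q, hqr, ?_⟩,
        mul_zero, add_zero] at h1
      · have h2 := hself (hZ q) fun p _ hp => by simp [Z, mix, hp]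
        have h3 : (contractDim H : ℂ) ≠ 0 := by
          have h4 : contractDim H * _ = _ := hx.prod_dim_outRest hH hf
          have h5 := x.outDim_ne_zero
          rw [← h4, Nat.cast_mul] at h5
          exact left_ne_zero_of_mul h5
        exact mul_ne_zero hr0 (mul_ne_zero h3 h2) h1
      · simp [Finset.disjoint_right.mp hUo hq]
      · intro q' hq' hne
        exact pair_prodOp_eq_zero (hZ q) (hZ q') ⟨q, hqr, by simp [hne.symm]⟩
    -- The component along `K` is orthogonal to all terms of `D`, as `U` avoids the remaining
    -- outputs; it is nonzero, so `U` must meet an output of `z`.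
    have hex : ∃ q ∈ U, q ∈ z.outSys := by
      by_contra hne
      push Not at hne
      have h1 := hdet.allowed U K hK hU
        ((Ty.good_of_disjoint_and_not_good U).2 (Finset.disjoint_left.mpr hne))
      rw [hexp, pair_add, hone hK hU, zero_add, pair_smul, pair_add, pair_smul, pair_smul,
        pair_sum, Finset.sum_eq_zero, mul_zero, zero_add] at h1
      · exact mul_ne_zero hr0 (mul_ne_zero hc0 (hself hK hKalt)) h1
      · intro q hq
        exact pair_prodOp_eq_zero hK (hZ q) ⟨q, (Finset.mem_inter.mp hq).2, by
          simp [Finset.disjoint_right.mp hUo hq]⟩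
    obtain ⟨q, hqU, hqz⟩ := hex
    have hqr : q ∈ remaining x.systems H := by
      rw [hzs]
      exact z.outSys_subset hqz
    have hqi : q ∈ x.inRest H := by
      rw [x.remaining_eq] at hqr
      exact (Finset.mem_union.mp hqr).resolve_right (Finset.disjoint_left.mp hUo hqU)
    -- The inputs of `z` are remaining inputs other than `q`, so `z.inDim` lacks the factor `q.dim ≥
    -- 2`, while the trace is still the full dimension of the remaining inputs.
    have hin : z.inSys ⊆ (x.inRest H).erase q := by
      intro p hp
      have hpo := Finset.disjoint_left.mp hz.disjoint_inSys_outSys hp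
      have hpr := z.inSys_subset hp
      rw [← hzs, x.remaining_eq] at hpr
      exact Finset.mem_erase.mpr ⟨fun h => hpo (h ▸ hqz),
        (Finset.mem_union.mp hpr).resolve_right fun h => hpo (hout h)⟩
    have htr := hdet.trace
    rw [hexp, Matrix.trace_add, htr1, Matrix.trace_smul, Matrix.trace_add, Matrix.trace_smul,
      Matrix.trace_smul, Matrix.trace_sum, hK.trace_prodOp hU, Finset.sum_eq_zero] at htr
    · rw [smul_zero, smul_zero, add_zero, smul_zero, add_zero, Nat.cast_inj,
        ← Finset.mul_prod_erase _ _ hqi] at htr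
      have h1 : z.inDim ≤ ∏ q ∈ (x.inRest H).erase q, q.dim :=
        Finset.prod_le_prod_of_subset_of_one_le' hin fun p _ _ =>
          Nat.one_le_iff_ne_zero.mpr p.dim_ne_zero
      have h2 := q.two_le
      have h3 : 0 < ∏ q ∈ (x.inRest H).erase q, q.dim :=
        Nat.pos_of_ne_zero (Ty.prod_dim_ne_zero _)
      nlinarith
    · intro p hp
      exact (hZ p).trace_prodOp (by simpa using (Finset.mem_inter.mp hp).2)

theorem multiContractionAdmissible_iff {x : Ty} (hx : x.Linear) {H : List EquivPair}
    (hH : ∀ p ∈ H, p.fst ∈ x.inputs ∧ p.snd ∈ x.outputs)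
    (hp : H.Pairwise fun p q => p.fst ≠ q.fst ∧ p.snd ≠ q.snd) :
    MultiContractionAdmissible x H ↔ x.strings ∩ badStrings x H = ∅ := by
  rw [strings_inter_badStrings_eq_empty hx hH]
  exact ⟨fun h U hU => not_obstructs_of_multiContractionAdmissible hx hH hp h hU,
    multiContractionAdmissible_of_not_obstructs hx hH (hx.fits hH hp)⟩

end HigherOrder

theorem mainTheorem7 (x : HigherOrder.Ty) (hx : x.Linear) :
    (∀ H : List HigherOrder.EquivPair,
      (∀ p ∈ H, p.fst ∈ x.inputs ∧ p.snd ∈ x.outputs) →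
      H.Pairwise (fun p q => p.fst ≠ q.fst ∧ p.snd ≠ q.snd) →
      (HigherOrder.MultiContractionAdmissible x H ↔
        x.strings ∩ HigherOrder.badStrings x H = ∅)) ∧
    (∀ p : HigherOrder.EquivPair, p.fst ∈ x.inputs → p.snd ∈ x.outputs →
      (HigherOrder.ContractionAdmissible x p ↔
        x.strings ∩ HigherOrder.badStringsPair x p.fst p.snd = ∅)) := by
  refine ⟨fun H hH hp => HigherOrder.multiContractionAdmissible_iff hx hH hp, fun p h1 h2 => ?_⟩
  rw [HigherOrder.badStringsPair_eq hx h1 h2]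
  -- Contracting the one-element list `[p]` is by definition `contract p`.
  exact HigherOrder.multiContractionAdmissible_iff (H := [p]) hx (by simp [h1, h2]) (by simp)
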